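/- Let $\mathbb{R}^3_H=\{\mathbf t=(t_1,t_2,t_3)\in\mathbb{R}^3: t_1+t_2+t_3=0\}$ with $\|\mathbf t\|=\max\{|t_1|,|t_2|,|t_3|\}$, let $\mathbb{Z}^3_H=\mathbb{R}^3_H\cap\mathbb{Z}^3$, and let $\Omega=\{\mathbf t\in\mathbb{R}^3_H: -1\le t_1,t_2,-t_3<1\}$. A function $f:\mathbb{R}^3_H\to\mathbb{C}$ is called $H$-periodic if $f(\mathbf t+\mathbf s)=f(\mathbf t)$ for all $\mathbf t,\mathbf s\in\mathbb{R}^3_H$ with $s_1\equiv s_2\equiv s_3 \pmod 3$ (that is, $s_1-s_2,\ s_2-s_3\in 3\mathbb{Z}$). Let $C(\overline\Omega)$ be the space of continuous $H$-periodic functions with the norm $\|f\|=\sup_{\mathbf t\in\overline\Omega}|f(\mathbf t)|$, and for $u>0$ let $$\omega_f(u)=\sup_{0<\|\mathbf t\|\le u}\|f-f(\cdot+\mathbf t)\|.$$ For $\mathbf j\in\mathbb{Z}^3_H$ put $\phi_{\mathbf j}(\mathbf t)=e^{\frac{2\pi i}{3}\langle\mathbf j,\mathbf t\rangle}$ and $\widehat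 f_{\mathbf j}=\frac1{|\Omega|}\int_\Omega f(\mathbf t)\overline{\phi_{\mathbf j}(\mathbf t)}\,d\mathbf t$, where $d\mathbf t$ is Lebesgue measure on the plane $\mathbb{R}^3_H$ and $|\Omega|$ is the measure of $\Omega$. The hexagonal partial sums and, for $\delta>0$, the Cesàro $(C,\delta)$ means are $$S_n(f)=\sum_{\mathbf j\in\mathbb{Z}^3_H,\ -n\le j_1,j_2,j_3\le n}\widehat f_{\mathbf j}\,\phi_{\mathbf j},\qquad S_n^{(\delta)}(f)=\frac1{A_n^{\delta}}\sum_{k=0}^{n}A_{n-k}^{\delta-1}S_k(f),\qquad A_n^{\delta}=\binom{n+\delta}{\delta}.$$ Theorem. For every $\delta>0$ there is a constant $K_\delta>0$, depending only on $\delta$, such that for all $f\in C(\overline\Omega)$ and all integers $n\ge1$ $$\|f-S_n^{(\delta)}(f)\|\le K_\delta\,\log(n+1)\,\omega_f\!\left(\frac{\log(n+1)}{(n+1)^{\delta}}\right)\quad\text{if } 0<\delta<1,$$ $$\|f-S_n^{(\delta)}(f)\|\le K_\delta\,\omega_f\!\left(\frac{(\log(n+1))^2}{n+1}\right)\quad\text{if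 } \delta\ge1.$$ -/

import Mathlib

namespace HexFourier

/-- The plane `t₁ + t₂ + t₃ = 0` in `ℝ³` (homogeneous coordinates). The norm it inherits from
`Fin 3 → ℝ` is `‖t‖ = max (|t₁|, |t₂|, |t₃|)`. -/
def plane : Submodule ℝ (Fin 3 → ℝ) where
  carrier := {t | t 0 + t 1 + t 2 = 0}
  add_mem' := by
    intro a b ha hb
    simp only [Set.mem_ofPred_eq, Pi.add_apply] at *
    linarith
  zero_mem' := by simp
  smul_mem' := by
    intro c a ha
    simp only [Set.mem_ofPred_eq, Pi.smul_apply, smul_eq_mul] at *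
    rw [← mul_add, ← mul_add, ha, mul_zero]

/-- The point of the plane whose first two homogeneous coordinates are given. -/
def ofPair (p : ℝ × ℝ) : plane :=
  ⟨![p.1, p.2, -p.1 - p.2], by
    change p.1 + p.2 + (-p.1 - p.2) = 0
    ring⟩

/-- Two-dimensional Lebesgue measure `dt = dt₁ dt₂` on the plane. All integrals below are
divided by the measure of the hexagon, so the normalization of the measure does not matter. -/
noncomputable def planeMeasure : MeasureTheory.Measure plane :=
  MeasureTheory.Measure.map ofPair MeasureTheory.volume

/-- The hexagon `Ω = {t : -1 ≤ t₁, t₂, -t₃ < 1}`. -/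
def hexagon : Set plane :=
  {t | (-1 ≤ t.1 0 ∧ t.1 0 < 1) ∧ (-1 ≤ t.1 1 ∧ t.1 1 < 1) ∧ (-1 ≤ -t.1 2 ∧ -t.1 2 < 1)}

/-- The congruence `t ≡ s (mod 3)`: `t₁ - s₁ ≡ t₂ - s₂ ≡ t₃ - s₃ (mod 3)`. -/
def CongrModThree (t s : plane) : Prop :=
  (∃ a : ℤ, (t.1 0 - s.1 0) - (t.1 1 - s.1 1) = 3 * (a : ℝ)) ∧
    (∃ b : ℤ, (t.1 1 - s.1 1) - (t.1 2 - s.1 2) = 3 * (b : ℝ))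

/-- Periodicity with respect to the hexagonal lattice. -/
def HPeriodic (f : plane → ℂ) : Prop :=
  ∀ s : plane, CongrModThree s 0 → ∀ t : plane, f (t + s) = f t

/-- The exponential `φ_j(t) = exp ((2πi/3) ⟨j, t⟩)`. -/
noncomputable def expChar (j : Fin 3 → ℤ) (t : plane) : ℂ :=
  Complex.exp (2 * (Real.pi : ℂ) * Complex.I / 3 * ((∑ i, (j i : ℝ) * t.1 i : ℝ) : ℂ))

/-- The Fourier coefficient `|Ω|⁻¹ ∫_Ω f(t) conj(φ_j(t)) dt`. -/
noncomputable def fourierCoeff (f : plane → ℂ) (j : Fin 3 → ℤ) : ℂ :=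
  (((planeMeasure.real hexagon)⁻¹ : ℝ) : ℂ) *
    ∫ t in hexagon, f t * (starRingEnd ℂ) (expChar j t) ∂planeMeasure

/-- The set `ℍ_n` of integer points `j` with `j₁ + j₂ + j₃ = 0` and `-n ≤ j₁, j₂, j₃ ≤ n`. -/
noncomputable def hexIndex (n : ℕ) : Finset (Fin 3 → ℤ) :=
  (Fintype.piFinset fun _ => Finset.Icc (-(n : ℤ)) (n : ℤ)).filter
    fun j => j 0 + j 1 + j 2 = 0

/-- The `n`-th hexagonal partial sum of the Fourier series of `f`. -/
noncomputable def partialSum (n : ℕ) (f : plane → ℂ) (t : plane) : ℂ :=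
  ∑ j ∈ hexIndex n, fourierCoeff f j * expChar j t

/-- The binomial coefficient with real entries,
`Γ(x+1) / (Γ(y+1) Γ(x-y+1))`. -/
noncomputable def realBinom (x y : ℝ) : ℝ :=
  Real.Gamma (x + 1) / (Real.Gamma (y + 1) * Real.Gamma (x - y + 1))

/-- The Cesàro number `A_n^δ = binom (n+δ) δ`; it is used for `δ > -1` only. -/
noncomputable def cesaroNumber (δ : ℝ) (n : ℕ) : ℝ := realBinom (n + δ) δ

/-- The Cesàro `(C,δ)` mean of the hexagonal Fourier series,
`(1 / A_n^δ) ∑_{k=0}^n A_{n-k}^{δ-1} S_k(f)(t)`. -/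
noncomputable def cesaroMean (δ : ℝ) (n : ℕ) (f : plane → ℂ) (t : plane) : ℂ :=
  ((1 / cesaroNumber δ n : ℝ) : ℂ) *
    ∑ k ∈ Finset.range (n + 1), (cesaroNumber (δ - 1) (n - k) : ℂ) * partialSum k f t

/-- The uniform norm over the closed hexagon. -/
noncomputable def uniformNorm (f : plane → ℂ) : ℝ :=
  sSup ((fun t => ‖f t‖) '' closure hexagon)

/-- The modulus of continuity `ω_f(u) = sup_{0 < ‖t‖ ≤ u} ‖f - f(· + t)‖`. -/
noncomputable def modulus (f : plane → ℂ) (u : ℝ) : ℝ :=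
  sSup ((fun t : plane => uniformNorm fun x => f x - f (x + t)) '' {t | 0 < ‖t‖ ∧ ‖t‖ ≤ u})

end HexFourier

/-!
Write `e(s) = exp (2πis)`. In the three coordinates `s₀ = (t₂ - t₁) / 3`, `s₁ = (t₀ - t₂) / 3`,
`s₂ = (t₁ - t₀) / 3`, whose sum is zero, the sum of the first `m` hexagonal Dirichlet kernels
factorizes as `∏ᵢ ∑_{k < m} e(k sᵢ)` (`sum_dirichletKernel`). Hence each Dirichlet kernel has a
closed form with three terms (`prod_one_sub_mul_dirichletKernel`).

The hexagon is a fundamental domain of the lattice of periods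
(`isAddFundamentalDomain_hexagon`), so the Cesàro mean is a convolution with the Cesàro kernel `K`,
whose mean is one. With `ω(‖t‖) ≤ (1 + ‖t‖ / u) ω(u)` the error is at most
`|Ω|⁻¹ ω(u) (∫ ‖K‖ + u⁻¹ ∫ ‖K‖ ‖t‖)` (`norm_sub_cesaroMean_le`), and it remains to bound the two
integrals. With `N = n + 1` and `h(s) = min (N, 1 / |s|)`:

* For `δ ≥ 1` the Cesàro weights are monotone, and Abel's inequality gives
  `‖K‖ ≲ N⁻¹ h(s₀) h(s₁) h(s₂)`. As the two largest of the `|sᵢ|` are comparable, this is at most a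
  constant times `N⁻¹ h(sᵢ)^(3/2) h(sⱼ)^(3/2)` for some `i ≠ j`, and `‖K‖ ‖t‖ ≲ N⁻¹ h(sᵢ) h(sⱼ)`.
  The integrals are therefore `O(1)` and `O((log N)² / N)` (`exists_moments_le_of_one_le`).
* For `0 < δ < 1` the closed form and the estimate
  `|∑_{k ≤ n} A_k^{δ-1} z^k| ≲ |1 - z|^(-δ)` bound `‖K‖` by `N^(-δ) |sᵢ|^(-1-δ) |sⱼ|⁻¹`, where `sᵢ`
  has the largest and `sⱼ` the smallest modulus. Together with `‖K‖ ≲ N²` this allows both powers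
  to be truncated near zero, `|sⱼ|⁻¹` at the scale `N⁻³`. The integrals are then `O(log N)` and
  `O(N^(-δ) log N)` (`exists_moments_le_of_lt_one`).

In both cases the pointwise bounds are products of functions of two of the coordinates `sᵢ`, which
are linear coordinates on the plane, so that only one-dimensional integrals have to be computed.
-/

namespace HexFourier

open MeasureTheory

/-! ### The plane and its Haar measure -/

lemma plane_sum_eq_zero (t : plane) : t.1 0 + t.1 1 + t.1 2 = 0 := t.2

/-- `ofPair` as a linear isomorphism; its inverse takes the first two homogeneous coordinates. -/
noncomputable def pairEquiv : (ℝ × ℝ) ≃ₗ[ℝ] plane where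
  toFun := ofPair
  invFun t := (t.1 0, t.1 1)
  map_add' p q := by
    ext i; fin_cases i <;> simp [ofPair]; ring
  map_smul' c p := by
    ext i; fin_cases i <;> simp [ofPair]; ring
  left_inv p := by simp [ofPair]
  right_inv t := by
    have := plane_sum_eq_zero t
    ext i; fin_cases i <;> simp [ofPair]; linarith

instance planeMeasure_isAddHaarMeasure : planeMeasure.IsAddHaarMeasure :=
  inferInstanceAs
    (Measure.map (pairEquiv.toContinuousLinearEquiv) (volume : Measure (ℝ × ℝ))).IsAddHaarMeasure

lemma continuous_coord (i : Fin 3) : Continuous fun t : plane => t.1 i :=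
  (continuous_apply i).comp continuous_subtype_val

lemma abs_coord_le_norm (t : plane) (i : Fin 3) : |t.1 i| ≤ ‖t‖ :=
  norm_le_pi_norm t.1 i

lemma measurableSet_hexagon : MeasurableSet hexagon := by
  have h (i : Fin 3) : Measurable fun t : plane => t.1 i := (continuous_coord i).measurable
  have h0 := h 0
  have h1 := h 1
  have h2 := (h 2).neg
  refine ((measurableSet_le measurable_const h0).inter
    (measurableSet_lt h0 measurable_const)).inter
    (((measurableSet_le measurable_const h1).inter
    (measurableSet_lt h1 measurable_const)).inter
    ((measurableSet_le measurable_const h2).inter (measurableSet_lt h2 measurable_const)))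

lemma hexagon_subset_closedBall : hexagon ⊆ Metric.closedBall 0 1 := by
  rintro t ⟨⟨a, b⟩, ⟨c, d⟩, e, f⟩
  rw [mem_closedBall_zero_iff, Submodule.coe_norm, pi_norm_le_iff_of_nonneg zero_le_one]
  intro i
  rw [Real.norm_eq_abs, abs_le]
  fin_cases i <;> constructor <;> simp <;> linarith

lemma isCompact_closure_hexagon : IsCompact (closure hexagon) :=
  (isCompact_closedBall (0 : plane) 1).of_isClosed_subset isClosed_closure
    (closure_minimal hexagon_subset_closedBall Metric.isClosed_closedBall)

lemma ball_subset_hexagon : Metric.ball 0 1 ⊆ hexagon := by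
  intro t ht
  rw [mem_ball_zero_iff] at ht
  have h (i : Fin 3) := abs_lt.1 ((abs_coord_le_norm t i).trans_lt ht)
  refine ⟨⟨(h 0).1.le, (h 0).2⟩, ⟨(h 1).1.le, (h 1).2⟩, ?_, ?_⟩ <;>
    linarith [(h 2).1, (h 2).2]

lemma measureReal_hexagon_pos : 0 < planeMeasure.real hexagon := by
  refine ENNReal.toReal_pos ?_ ?_
  · exact ((Metric.measure_ball_pos planeMeasure (0 : plane) one_pos).trans_le
      (measure_mono ball_subset_hexagon)).ne'
  · exact ((measure_mono hexagon_subset_closedBall).trans_lt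
      (isCompact_closedBall (0 : plane) 1).measure_lt_top).ne

lemma integrableOn_hexagon {E : Type*} [NormedAddCommGroup E] {g : plane → E}
    (hg : Continuous g) : IntegrableOn g hexagon planeMeasure :=
  (hg.continuousOn.integrableOn_compact (isCompact_closedBall (0 : plane) 1)).mono_set
    hexagon_subset_closedBall

/-! ### The hexagon as a fundamental domain of the period lattice -/

/-- The integer points `(2a + b, b - a, -a - 2b)`, which are exactly the periods. -/
def latticeHom : ℤ × ℤ →+ plane where
  toFun p := ⟨![2 * p.1 + p.2, p.2 - p.1, -p.1 - 2 * p.2], by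
    change (2 * p.1 + p.2 : ℝ) + (p.2 - p.1) + (-p.1 - 2 * p.2) = 0
    ring⟩
  map_zero' := by ext i; fin_cases i <;> simp
  map_add' p q := by ext i; fin_cases i <;> simp <;> ring

/-- The lattice of periods of an `H`-periodic function. -/
def periodLattice : AddSubgroup plane := latticeHom.range

lemma congrModThree_latticeHom (p : ℤ × ℤ) : CongrModThree (latticeHom p) 0 := by
  refine ⟨⟨p.1, ?_⟩, ⟨p.2, ?_⟩⟩ <;> simp [latticeHom] <;> ring

lemma HPeriodic.vadd {E : Type*} {f : plane → ℂ} (hf : HPeriodic f) (F : ℂ → E)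
    (g : periodLattice) (t : plane) : F (f (g +ᵥ t)) = F (f t) := by
  obtain ⟨_, p, rfl⟩ := g
  rw [AddSubgroup.vadd_def, vadd_eq_add, add_comm, hf _ (congrModThree_latticeHom p)]

instance : Countable periodLattice :=
  (Set.countable_range latticeHom).to_subtype

lemma existsUnique_latticeHom_add_mem (t : plane) : ∃! p : ℤ × ℤ, latticeHom p + t ∈ hexagon := by
  have hs := plane_sum_eq_zero t
  -- the lattice acts on `u = (t₀ - t₂) / 3` and `v = (t₁ - t₂) / 3` by integer translations
  have key (p : ℤ × ℤ) (u v : ℝ) (hu : u = (t.1 0 - t.1 2) / 3 + (p.1 + p.2))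
      (hv : v = (t.1 1 - t.1 2) / 3 + p.2) : latticeHom p + t ∈ hexagon ↔
      (-1 ≤ 2 * u - v ∧ 2 * u - v < 1) ∧ (-1 ≤ 2 * v - u ∧ 2 * v - u < 1) ∧
        (-1 ≤ u + v ∧ u + v < 1) := by
    have e0 : (latticeHom p + t).1 0 = 2 * u - v := by
      simp [latticeHom]; linarith
    have e1 : (latticeHom p + t).1 1 = 2 * v - u := by
      simp [latticeHom]; linarith
    have e2 : -(latticeHom p + t).1 2 = u + v := by
      simp [latticeHom]; linarith
    simp only [hexagon, Set.mem_ofPred_eq, e0, e1, e2]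
  obtain ⟨u, m, hu, hu0, hu1⟩ : ∃ (u : ℝ) (m : ℤ), (t.1 0 - t.1 2) / 3 = u + m ∧ 0 ≤ u ∧ u < 1 :=
    ⟨_, _, (Int.fract_add_floor _).symm, Int.fract_nonneg _, Int.fract_lt_one _⟩
  obtain ⟨v, l, hv, hv0, hv1⟩ : ∃ (v : ℝ) (l : ℤ), (t.1 1 - t.1 2) / 3 = v + l ∧ 0 ≤ v ∧ v < 1 :=
    ⟨_, _, (Int.fract_add_floor _).symm, Int.fract_nonneg _, Int.fract_lt_one _⟩
  have shift (a b : ℤ) : latticeHom (a - m - (b - l), b - l) + t ∈ hexagon ↔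
      (-1 ≤ 2 * (u + a) - (v + b) ∧ 2 * (u + a) - (v + b) < 1) ∧
      (-1 ≤ 2 * (v + b) - (u + a) ∧ 2 * (v + b) - (u + a) < 1) ∧
        (-1 ≤ (u + a) + (v + b) ∧ (u + a) + (v + b) < 1) :=
    key _ (u + a) (v + b) (by push_cast; linarith) (by push_cast; linarith)
  apply existsUnique_of_exists_of_unique
  · suffices ∃ a b : ℤ, latticeHom (a - m - (b - l), b - l) + t ∈ hexagon from
      let ⟨a, b, h⟩ := this; ⟨_, h⟩
    simp only [shift]
    by_cases h1 : 1 ≤ 2 * u - v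
    · by_cases h2 : 2 * v < u
      · refine ⟨-1, 0, ?_⟩
        push_cast
        refine ⟨⟨?_, ?_⟩, ⟨?_, ?_⟩, ?_, ?_⟩ <;> linarith
      · refine ⟨-1, -1, ?_⟩
        push_cast
        refine ⟨⟨?_, ?_⟩, ⟨?_, ?_⟩, ?_, ?_⟩ <;> linarith
    · by_cases h2 : 1 ≤ 2 * v - u
      · by_cases h3 : 2 * u < v
        · refine ⟨0, -1, ?_⟩
          push_cast
          refine ⟨⟨?_, ?_⟩, ⟨?_, ?_⟩, ?_, ?_⟩ <;> linarith
        · refine ⟨-1, -1, ?_⟩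
          push_cast
          refine ⟨⟨?_, ?_⟩, ⟨?_, ?_⟩, ?_, ?_⟩ <;> linarith
      · by_cases h3 : u + v < 1
        · refine ⟨0, 0, ?_⟩
          push_cast
          refine ⟨⟨?_, ?_⟩, ⟨?_, ?_⟩, ?_, ?_⟩ <;> linarith
        · refine ⟨-1, -1, ?_⟩
          push_cast
          refine ⟨⟨?_, ?_⟩, ⟨?_, ?_⟩, ?_, ?_⟩ <;> linarith
  · intro p q hp hq
    rw [key p _ _ rfl rfl] at hp
    rw [key q _ _ rfl rfl] at hq
    obtain ⟨⟨a1, a2⟩, ⟨a3, a4⟩, a5, a6⟩ := hp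
    obtain ⟨⟨b1, b2⟩, ⟨b3, b4⟩, b5, b6⟩ := hq
    have c1 : 2 * (p.1 + p.2) - p.2 < 2 * (q.1 + q.2) - q.2 + 2 := by
      exact_mod_cast (by linarith : (2 * (p.1 + p.2) - p.2 : ℝ) < 2 * (q.1 + q.2) - q.2 + 2)
    have c2 : 2 * (q.1 + q.2) - q.2 < 2 * (p.1 + p.2) - p.2 + 2 := by
      exact_mod_cast (by linarith : (2 * (q.1 + q.2) - q.2 : ℝ) < 2 * (p.1 + p.2) - p.2 + 2)
    have c3 : 2 * p.2 - (p.1 + p.2) < 2 * q.2 - (q.1 + q.2) + 2 := by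
      exact_mod_cast (by linarith : (2 * p.2 - (p.1 + p.2) : ℝ) < 2 * q.2 - (q.1 + q.2) + 2)
    have c4 : 2 * q.2 - (q.1 + q.2) < 2 * p.2 - (p.1 + p.2) + 2 := by
      exact_mod_cast (by linarith : (2 * q.2 - (q.1 + q.2) : ℝ) < 2 * p.2 - (p.1 + p.2) + 2)
    have c5 : p.1 + p.2 + p.2 < q.1 + q.2 + q.2 + 2 := by
      exact_mod_cast (by linarith : (p.1 + p.2 + p.2 : ℝ) < q.1 + q.2 + q.2 + 2)
    have c6 : q.1 + q.2 + q.2 < p.1 + p.2 + p.2 + 2 := by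
      exact_mod_cast (by linarith : (q.1 + q.2 + q.2 : ℝ) < p.1 + p.2 + p.2 + 2)
    ext <;> omega

lemma isAddFundamentalDomain_hexagon :
    IsAddFundamentalDomain periodLattice hexagon planeMeasure := by
  refine IsAddFundamentalDomain.mk' measurableSet_hexagon.nullMeasurableSet fun t => ?_
  obtain ⟨p, hp, hu⟩ := existsUnique_latticeHom_add_mem t
  refine ⟨⟨latticeHom p, p, rfl⟩, hp, ?_⟩
  rintro ⟨_, q, rfl⟩ hq
  exact Subtype.ext (congrArg latticeHom (hu q hq))

open scoped Pointwise in
lemma HPeriodic.setIntegral_add_left {f : plane → ℂ} (hf : HPeriodic f) (x : plane) :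
    ∫ t in hexagon, f (x + t) ∂planeMeasure = ∫ t in hexagon, f t ∂planeMeasure := by
  have h := isAddFundamentalDomain_hexagon.setIntegral_eq
    (isAddFundamentalDomain_hexagon.vadd_of_comm x) (f := f) (fun g t => hf.vadd id g t)
  have hpre : (fun t => x + t) ⁻¹' (x +ᵥ hexagon) = hexagon := by
    ext t
    simp [Set.mem_vadd_set_iff_neg_vadd_mem]
  have h' := (measurePreserving_add_left planeMeasure x).setIntegral_preimage_emb
    (measurableEmbedding_addLeft x) f (x +ᵥ hexagon)
  rw [h, ← h', hpre]

/-- Values of a periodic function near any point are also taken near a point of the hexagon. -/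
lemma HPeriodic.exists_mem_hexagon {f : plane → ℂ} (hf : HPeriodic f) (t : plane) :
    ∃ s ∈ hexagon, ∀ r, f (t + r) = f (s + r) := by
  obtain ⟨p, hp, -⟩ := existsUnique_latticeHom_add_mem t
  refine ⟨_, hp, fun r => ?_⟩
  rw [← hf _ (congrModThree_latticeHom p) (t + r)]
  congr 1
  abel

/-! ### The modulus of continuity -/

lemma HPeriodic.exists_norm_le {f : plane → ℂ} (hc : Continuous f) (hf : HPeriodic f) :
    ∃ M, ∀ t, ‖f t‖ ≤ M := by
  obtain ⟨M, hM⟩ := isCompact_closure_hexagon.exists_bound_of_continuousOn hc.continuousOn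
  refine ⟨M, fun t => ?_⟩
  obtain ⟨s, hs, h⟩ := hf.exists_mem_hexagon t
  rw [← add_zero t, h 0, add_zero]
  exact hM s (subset_closure hs)

lemma HPeriodic.norm_sub_le_modulus {f : plane → ℂ} (hc : Continuous f) (hf : HPeriodic f)
    {u : ℝ} (x : plane) {t : plane} (ht : ‖t‖ ≤ u) :
    ‖f x - f (x + t)‖ ≤ modulus f u := by
  obtain ⟨M, hM⟩ := hf.exists_norm_le hc
  have hbd (y s : plane) : ‖f y - f (y + s)‖ ≤ M + M :=
    (norm_sub_le _ _).trans (add_le_add (hM _) (hM _))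
  have hM0 : 0 ≤ M + M := (norm_nonneg _).trans (hbd 0 0)
  have hmod (s : plane) (h0 : 0 < ‖s‖) (h : ‖s‖ ≤ u) :
      uniformNorm (fun y => f y - f (y + s)) ≤ modulus f u := by
    refine le_csSup ⟨M + M, ?_⟩ ⟨s, ⟨h0, h⟩, rfl⟩
    rintro _ ⟨s, -, rfl⟩
    refine Real.sSup_le ?_ hM0
    rintro _ ⟨y, -, rfl⟩
    exact hbd y s
  have hnn (s : plane) : 0 ≤ uniformNorm (fun y => f y - f (y + s)) := by
    refine Real.sSup_nonneg ?_
    rintro _ ⟨y, -, rfl⟩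
    exact norm_nonneg _
  rcases eq_or_ne t 0 with rfl | h0
  · rw [add_zero, sub_self, norm_zero]
    refine Real.sSup_nonneg ?_
    rintro _ ⟨s, -, rfl⟩
    exact hnn s
  · refine le_trans ?_ (hmod t (norm_pos_iff.2 h0) ht)
    obtain ⟨s, hs, h⟩ := hf.exists_mem_hexagon x
    rw [h t, ← add_zero x, h 0, add_zero]
    refine le_csSup ⟨M + M, ?_⟩ ⟨s, subset_closure hs, rfl⟩
    rintro _ ⟨y, -, rfl⟩
    exact hbd y t

/-- A translation by `t` is divided into `⌈‖t‖ / u⌉` translations of length at most `u`. -/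
lemma HPeriodic.norm_sub_le_mul_modulus {f : plane → ℂ} (hc : Continuous f) (hf : HPeriodic f)
    {u : ℝ} (hu : 0 < u) (x t : plane) :
    ‖f x - f (x + t)‖ ≤ (1 + ‖t‖ / u) * modulus f u := by
  have hnn : 0 ≤ modulus f u :=
    (norm_nonneg _).trans (hf.norm_sub_le_modulus hc 0 (t := 0) (by simpa using hu.le))
  have hchain (s : plane) (hs : ‖s‖ ≤ u) (k : ℕ) :
      ‖f x - f (x + k • s)‖ ≤ k * modulus f u := by
    induction k with
    | zero => simp
    | succ k ih =>
      have h := hf.norm_sub_le_modulus hc (x + k • s) hs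
      rw [succ_nsmul, ← add_assoc]
      calc _ ≤ ‖f x - f (x + k • s)‖ + ‖f (x + k • s) - f (x + k • s + s)‖ :=
            norm_sub_le_norm_sub_add_norm_sub _ _ _
        _ ≤ k * modulus f u + modulus f u := add_le_add ih h
        _ = _ := by push_cast; ring
  rcases eq_or_ne t 0 with rfl | h0
  · simpa using hnn
  have hpos : 0 < ‖t‖ / u := div_pos (norm_pos_iff.2 h0) hu
  set k := ⌈‖t‖ / u⌉₊
  have hk : 0 < (k : ℝ) := Nat.cast_pos.2 (Nat.ceil_pos.2 hpos)
  have hs : ‖(k : ℝ)⁻¹ • t‖ ≤ u := by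
    rw [norm_smul, norm_inv, Real.norm_natCast, inv_mul_le_iff₀ hk]
    exact (div_le_iff₀ hu).1 (Nat.le_ceil _)
  have h := hchain _ hs k
  rw [← Nat.cast_smul_eq_nsmul ℝ, smul_inv_smul₀ hk.ne'] at h
  refine h.trans (mul_le_mul_of_nonneg_right ?_ hnn)
  linarith [Nat.ceil_lt_add_one hpos.le]

open Finset

/-! ### The hexagonal Dirichlet kernel -/

/-- The coordinates `(t₂ - t₁) / 3`, `(t₀ - t₂) / 3`, `(t₁ - t₀) / 3` of a point of the plane: the
projections to the three directions in which the Dirichlet kernel factorizes. -/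
noncomputable def edgeCoord (i : Fin 3) (t : plane) : ℝ := (t.1 (i + 2) - t.1 (i + 1)) / 3

/-- The unimodular number `exp (2πi s)` for an edge coordinate `s`. -/
noncomputable def edgeExp (i : Fin 3) (t : plane) : ℂ :=
  Complex.exp ((2 * Real.pi * edgeCoord i t : ℝ) * Complex.I)

/-- The kernel `∑_{j ∈ ℍ_n} φ_j` of the hexagonal partial sums. -/
noncomputable def dirichletKernel (n : ℕ) (t : plane) : ℂ := ∑ j ∈ hexIndex n, expChar j t

lemma edgeCoord_zero (t : plane) : edgeCoord 0 t = (t.1 2 - t.1 1) / 3 := rfl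
lemma edgeCoord_one (t : plane) : edgeCoord 1 t = (t.1 0 - t.1 2) / 3 := rfl
lemma edgeCoord_two (t : plane) : edgeCoord 2 t = (t.1 1 - t.1 0) / 3 := rfl

lemma edgeCoord_sum (t : plane) : edgeCoord 0 t + edgeCoord 1 t + edgeCoord 2 t = 0 := by
  rw [edgeCoord_zero, edgeCoord_one, edgeCoord_two]
  ring

lemma edgeCoord_neg (i : Fin 3) (t : plane) : edgeCoord i (-t) = -edgeCoord i t := by
  simp [edgeCoord]; ring

lemma norm_edgeExp (i : Fin 3) (t : plane) : ‖edgeExp i t‖ = 1 :=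
  Complex.norm_exp_ofReal_mul_I _

lemma edgeExp_mul (t : plane) : edgeExp 0 t * edgeExp 1 t * edgeExp 2 t = 1 := by
  rw [edgeExp, edgeExp, edgeExp, ← Complex.exp_add, ← Complex.exp_add, ← Complex.exp_zero]
  congr 1
  rw [← add_mul, ← add_mul, ← Complex.ofReal_add, ← Complex.ofReal_add, ← mul_add, ← mul_add,
    edgeCoord_sum]
  simp

lemma expChar_of_triple (a b c : ℕ) (t : plane) :
    expChar ![(b : ℤ) - c, (c : ℤ) - a, (a : ℤ) - b] t =
      edgeExp 0 t ^ a * edgeExp 1 t ^ b * edgeExp 2 t ^ c := by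
  rw [expChar, edgeExp, edgeExp, edgeExp, ← Complex.exp_nat_mul, ← Complex.exp_nat_mul,
    ← Complex.exp_nat_mul, ← Complex.exp_add, ← Complex.exp_add]
  congr 1
  rw [edgeCoord_zero, edgeCoord_one, edgeCoord_two, Fin.sum_univ_three]
  simp
  ring

/-- Every point of `ℍ_n` is `(b - c, c - a, a - b)` for a unique triple of natural numbers with
maximum `n`, so the Dirichlet kernel is a difference of products of geometric sums. -/
lemma dirichletKernel_eq_sub (n : ℕ) (t : plane) :
    dirichletKernel n t = ∏ i, ∑ k ∈ range (n + 1), edgeExp i t ^ k -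
      ∏ i, ∑ k ∈ range n, edgeExp i t ^ k := by
  have hprod (m : ℕ) : ∏ i, ∑ k ∈ range m, edgeExp i t ^ k =
      ∑ p ∈ (range m ×ˢ range m) ×ˢ range m,
        edgeExp 0 t ^ p.1.1 * edgeExp 1 t ^ p.1.2 * edgeExp 2 t ^ p.2 := by
    rw [Fin.prod_univ_three, sum_mul_sum, ← sum_product', sum_mul_sum, ← sum_product']
  have hsub : (range n ×ˢ range n) ×ˢ range n ⊆
      (range (n + 1) ×ˢ range (n + 1)) ×ˢ range (n + 1) := by
    have := range_mono n.le_succ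
    exact product_subset_product (product_subset_product this this) this
  rw [hprod, hprod, ← sum_sdiff hsub, add_sub_cancel_right, dirichletKernel]
  symm
  refine sum_bij (fun p _ => ![(p.1.2 : ℤ) - p.2, (p.2 : ℤ) - p.1.1, (p.1.1 : ℤ) - p.1.2])
    ?_ ?_ ?_ ?_
  · rintro ⟨⟨a, b⟩, c⟩ h
    simp only [mem_sdiff, mem_product, mem_range] at h
    simp only [hexIndex, mem_filter, Fintype.mem_piFinset, mem_Icc, Fin.forall_fin_succ]
    simp
    omega
  · rintro ⟨⟨a, b⟩, c⟩ h ⟨⟨a', b'⟩, c'⟩ h' he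
    simp only [mem_sdiff, mem_product, mem_range] at h h'
    have h0 := congrFun he 0
    have h1 := congrFun he 1
    have h2 := congrFun he 2
    simp at h0 h1 h2
    simp only [Prod.mk.injEq]
    omega
  · intro j hj
    simp only [hexIndex, mem_filter, Fintype.mem_piFinset, mem_Icc] at hj
    obtain ⟨hj, hs⟩ := hj
    have h0 := hj 0
    have h1 := hj 1
    have h2 := hj 2
    obtain ⟨a, ha⟩ : ∃ a : ℕ, (a : ℤ) = n - max 0 (max (-j 2) (j 1)) :=
      ⟨(n - max 0 (max (-j 2) (j 1))).toNat, Int.toNat_of_nonneg (by omega)⟩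
    obtain ⟨b, hb⟩ : ∃ b : ℕ, (b : ℤ) = a - j 2 := ⟨(a - j 2).toNat, Int.toNat_of_nonneg (by omega)⟩
    obtain ⟨c, hc⟩ : ∃ c : ℕ, (c : ℤ) = a + j 1 := ⟨(a + j 1).toNat, Int.toNat_of_nonneg (by omega)⟩
    refine ⟨((a, b), c), ?_, ?_⟩
    · simp only [mem_sdiff, mem_product, mem_range]
      omega
    · ext i
      fin_cases i <;> simp <;> omega
  · rintro ⟨⟨a, b⟩, c⟩ -
    exact (expChar_of_triple a b c t).symm

lemma sum_dirichletKernel (m : ℕ) (t : plane) :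
    ∑ n ∈ range m, dirichletKernel n t = ∏ i, ∑ k ∈ range m, edgeExp i t ^ k := by
  simp only [dirichletKernel_eq_sub]
  rw [sum_range_sub fun m => ∏ i, ∑ k ∈ range m, edgeExp i t ^ k]
  simp

/-- The three-term closed form of the Dirichlet kernel. -/
lemma prod_one_sub_mul_dirichletKernel (n : ℕ) (t : plane) :
    (∏ i, (1 - edgeExp i t)) * dirichletKernel n t =
      ∑ i, (1 - edgeExp i t) * (edgeExp i t ^ n + (edgeExp i t)⁻¹ ^ (n + 1)) := by
  have hgeom (m : ℕ) : (∏ i, (1 - edgeExp i t)) * ∏ i, ∑ k ∈ range m, edgeExp i t ^ k =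
      ∏ i, (1 - edgeExp i t ^ m) := by
    rw [← prod_mul_distrib]
    exact prod_congr rfl fun i _ => mul_neg_geom_sum _ _
  have hexpand (m : ℕ) : ∏ i, (1 - edgeExp i t ^ m) =
      ∑ i, ((edgeExp i t)⁻¹ ^ m - edgeExp i t ^ m) := by
    have h : edgeExp 0 t ^ m * edgeExp 1 t ^ m * edgeExp 2 t ^ m = 1 := by
      rw [← mul_pow, ← mul_pow, edgeExp_mul, one_pow]
    have h0 : (edgeExp 0 t)⁻¹ ^ m = edgeExp 1 t ^ m * edgeExp 2 t ^ m := by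
      rw [inv_pow]; exact inv_eq_of_mul_eq_one_right (by linear_combination h)
    have h1 : (edgeExp 1 t)⁻¹ ^ m = edgeExp 0 t ^ m * edgeExp 2 t ^ m := by
      rw [inv_pow]; exact inv_eq_of_mul_eq_one_right (by linear_combination h)
    have h2 : (edgeExp 2 t)⁻¹ ^ m = edgeExp 0 t ^ m * edgeExp 1 t ^ m := by
      rw [inv_pow]; exact inv_eq_of_mul_eq_one_right (by linear_combination h)
    rw [Fin.prod_univ_three, Fin.sum_univ_three, h0, h1, h2]
    linear_combination -h
  rw [dirichletKernel_eq_sub, mul_sub, hgeom, hgeom, hexpand, hexpand, ← sum_sub_distrib]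
  refine sum_congr rfl fun i _ => ?_
  have h : edgeExp i t * (edgeExp i t)⁻¹ = 1 := mul_inv_cancel₀ (Complex.exp_ne_zero _)
  rw [pow_succ, pow_succ]
  linear_combination (edgeExp i t)⁻¹ ^ n * h

lemma norm_expChar (j : Fin 3 → ℤ) (t : plane) : ‖expChar j t‖ = 1 := by
  rw [expChar, ← Complex.norm_exp_ofReal_mul_I (2 * Real.pi / 3 * ∑ i, (j i : ℝ) * t.1 i)]
  congr 2
  push_cast
  ring

lemma norm_dirichletKernel_le (n : ℕ) (t : plane) :
    ‖dirichletKernel n t‖ ≤ 4 * ((n : ℝ) + 1) ^ 2 := by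
  have hcard : #(hexIndex n) ≤ (2 * n + 1) * (2 * n + 1) := by
    have : #(Icc (-(n : ℤ)) n ×ˢ Icc (-(n : ℤ)) n) = (2 * n + 1) * (2 * n + 1) := by
      rw [card_product, Int.card_Icc]
      congr <;> omega
    rw [← this]
    refine card_le_card_of_injOn (fun j => (j 0, j 1)) ?_ ?_
    · intro j hj
      simp only [hexIndex, coe_filter, Fintype.mem_piFinset, Set.mem_ofPred_eq] at hj
      exact mem_product.2 ⟨hj.1 0, hj.1 1⟩
    · intro j hj j' hj' h
      simp only [hexIndex, coe_filter, Fintype.mem_piFinset, Set.mem_ofPred_eq] at hj hj'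
      simp only [Prod.mk.injEq] at h
      ext i
      fin_cases i
      · exact h.1
      · exact h.2
      · have := hj.2; have := hj'.2; simp; omega
  refine (norm_sum_le _ _).trans ?_
  simp only [norm_expChar, sum_const, nsmul_eq_mul, mul_one]
  have : (#(hexIndex n) : ℝ) ≤ (2 * n + 1) * (2 * n + 1) := by exact_mod_cast hcard
  nlinarith [(Nat.cast_nonneg n : (0 : ℝ) ≤ n)]

/-! ### Comparison of chords and arcs -/

lemma abs_le_abs_sin_pi_mul {s : ℝ} (hs : |s| ≤ 2 / 3) : |s| ≤ |Real.sin (Real.pi * s)| := by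
  wlog h0 : 0 ≤ s generalizing s
  · simpa using this (s := -s) (by rwa [abs_neg]) (by linarith)
  have hpi := Real.pi_pos
  rw [abs_of_nonneg h0] at hs ⊢
  refine le_trans ?_ (le_abs_self _)
  rcases le_total s (1 / 2) with h | h
  · have := Real.mul_le_sin (x := Real.pi * s) (by positivity) (by nlinarith)
    have e : 2 / Real.pi * (Real.pi * s) = 2 * s := by field_simp
    linarith
  · have := Real.mul_le_sin (x := Real.pi * (1 - s)) (by nlinarith) (by nlinarith)
    have e : 2 / Real.pi * (Real.pi * (1 - s)) = 2 * (1 - s) := by field_simp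
    rw [show Real.pi * (1 - s) = Real.pi - Real.pi * s by ring, Real.sin_pi_sub] at this
    rw [show Real.pi * (1 - s) = Real.pi - Real.pi * s by ring] at e
    linarith

lemma norm_one_sub_edgeExp (i : Fin 3) (t : plane) :
    ‖1 - edgeExp i t‖ = 2 * |Real.sin (Real.pi * edgeCoord i t)| := by
  rw [norm_sub_rev, edgeExp, mul_comm, Complex.norm_exp_I_mul_ofReal_sub_one, norm_mul,
    Real.norm_two, Real.norm_eq_abs]
  congr 3
  ring

lemma abs_edgeCoord_le_norm {i : Fin 3} {t : plane} (h : |edgeCoord i t| ≤ 2 / 3) :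
    |edgeCoord i t| ≤ ‖1 - edgeExp i t‖ := by
  rw [norm_one_sub_edgeExp]
  linarith [abs_le_abs_sin_pi_mul h, abs_nonneg (edgeCoord i t)]

lemma norm_le_abs_edgeCoord (i : Fin 3) (t : plane) :
    ‖1 - edgeExp i t‖ ≤ 7 * |edgeCoord i t| := by
  have h := Real.abs_sin_le_abs (x := Real.pi * edgeCoord i t)
  rw [abs_mul, abs_of_pos Real.pi_pos] at h
  rw [norm_one_sub_edgeExp]
  nlinarith [Real.pi_lt_d2, abs_nonneg (edgeCoord i t)]

lemma abs_edgeCoord_le_of_mem {t : plane} (ht : t ∈ hexagon) (i : Fin 3) :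
    |edgeCoord i t| ≤ 2 / 3 := by
  obtain ⟨⟨a, b⟩, ⟨c, d⟩, e, f⟩ := ht
  rw [abs_le]
  fin_cases i <;> simp only [edgeCoord_zero, edgeCoord_one, edgeCoord_two, Fin.zero_eta,
    Fin.mk_one, Fin.reduceFinMk] <;> constructor <;> linarith

lemma norm_le_of_abs_edgeCoord_le {t : plane} {X : ℝ} (h : ∀ i, |edgeCoord i t| ≤ X) :
    ‖t‖ ≤ 2 * X := by
  have h0 := abs_le.1 (h 0)
  have h1 := abs_le.1 (h 1)
  have h2 := abs_le.1 (h 2)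
  have hs := plane_sum_eq_zero t
  rw [edgeCoord_zero] at h0
  rw [edgeCoord_one] at h1
  rw [edgeCoord_two] at h2
  rw [Submodule.coe_norm, pi_norm_le_iff_of_nonneg (by linarith [(abs_nonneg _).trans (h 0)])]
  intro i
  rw [Real.norm_eq_abs, abs_le]
  fin_cases i <;> constructor <;> simp <;> linarith

/-- Since the edge coordinates sum to zero, the two largest of them are comparable. -/
lemma exists_extremal_edgeCoord (t : plane) : ∃ i j k : Fin 3, i ≠ j ∧
    (∀ f : Fin 3 → ℝ, ∏ l, f l = f i * f j * f k) ∧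
    |edgeCoord i t| ≤ |edgeCoord j t| ∧ (∀ l, |edgeCoord l t| ≤ |edgeCoord j t|) ∧
    |edgeCoord j t| ≤ 2 * |edgeCoord k t| := by
  have key (i j k : Fin 3) (hij : i ≠ j) (hs : edgeCoord j t = -(edgeCoord i t + edgeCoord k t))
      (hu : (Finset.univ : Finset (Fin 3)) = {i, j, k}) (hik : i ≠ k) (hjk : j ≠ k)
      (h1 : |edgeCoord i t| ≤ |edgeCoord k t|) (h2 : |edgeCoord k t| ≤ |edgeCoord j t|) :
      ∃ i j k : Fin 3, i ≠ j ∧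
        (∀ f : Fin 3 → ℝ, ∏ l, f l = f i * f j * f k) ∧
        |edgeCoord i t| ≤ |edgeCoord j t| ∧ (∀ l, |edgeCoord l t| ≤ |edgeCoord j t|) ∧
        |edgeCoord j t| ≤ 2 * |edgeCoord k t| := by
    refine ⟨i, j, k, hij, fun f => ?_, h1.trans h2, fun l => ?_, ?_⟩
    · rw [hu, prod_insert (by simp [hij, hik]), prod_insert (by simp [hjk]), prod_singleton,
        mul_assoc]
    · have : l ∈ ({i, j, k} : Finset (Fin 3)) := hu ▸ mem_univ l
      simp only [mem_insert, mem_singleton] at this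
      rcases this with rfl | rfl | rfl
      exacts [h1.trans h2, le_rfl, h2]
    · rw [hs, abs_neg]
      linarith [abs_add_le (edgeCoord i t) (edgeCoord k t)]
  have hs := edgeCoord_sum t
  rcases le_total |edgeCoord 0 t| |edgeCoord 1 t| with h | h <;>
  rcases le_total |edgeCoord 1 t| |edgeCoord 2 t| with h' | h' <;>
  rcases le_total |edgeCoord 0 t| |edgeCoord 2 t| with h'' | h''
  · exact key 0 2 1 (by decide) (by linarith) (by decide) (by decide) (by decide) h h'
  · exact key 0 2 1 (by decide) (by linarith) (by decide) (by decide) (by decide) h h'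
  · exact key 0 1 2 (by decide) (by linarith) (by decide) (by decide) (by decide) h'' h'
  · exact key 2 1 0 (by decide) (by linarith) (by decide) (by decide) (by decide) h'' h
  · exact key 1 2 0 (by decide) (by linarith) (by decide) (by decide) (by decide) h h''
  · exact key 1 0 2 (by decide) (by linarith) (by decide) (by decide) (by decide) h' h''
  · exact key 2 0 1 (by decide) (by linarith) (by decide) (by decide) (by decide) h' h
  · exact key 2 0 1 (by decide) (by linarith) (by decide) (by decide) (by decide) h' h

/-! ### Abel summation and the Cesàro numbers -/

/-- Abel's inequality. -/
lemma norm_sum_mul_le_of_antitone {c : ℕ → ℝ} (hc : Antitone c) (h0 : ∀ n, 0 ≤ c n)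
    {d : ℕ → ℂ} {B : ℝ} {n : ℕ} (hB : ∀ m ≤ n, ‖∑ k ∈ range m, d k‖ ≤ B) :
    ‖∑ k ∈ range n, (c k : ℂ) * d k‖ ≤ c 0 * B := by
  have key : ∀ m ≤ n, ‖∑ k ∈ range m, (c k : ℂ) * d k - c m * ∑ k ∈ range m, d k‖ ≤
      (c 0 - c m) * B := by
    intro m
    induction m with
    | zero => simp
    | succ m ih =>
      intro hm
      have e : ∑ k ∈ range (m + 1), (c k : ℂ) * d k - c (m + 1) * ∑ k ∈ range (m + 1), d k =
          (∑ k ∈ range m, (c k : ℂ) * d k - c m * ∑ k ∈ range m, d k) +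
            ((c m - c (m + 1) : ℝ) : ℂ) * ∑ k ∈ range (m + 1), d k := by
        rw [sum_range_succ, sum_range_succ]
        push_cast
        ring
      have hd : 0 ≤ c m - c (m + 1) := sub_nonneg.2 (hc m.le_succ)
      rw [e]
      refine (norm_add_le _ _).trans ?_
      rw [norm_mul, Complex.norm_real, Real.norm_of_nonneg hd]
      nlinarith [ih (by omega), mul_le_mul_of_nonneg_left (hB _ hm) hd]
  have e : ∑ k ∈ range n, (c k : ℂ) * d k =
      (∑ k ∈ range n, (c k : ℂ) * d k - c n * ∑ k ∈ range n, d k) +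
        (c n : ℂ) * ∑ k ∈ range n, d k := by ring
  rw [e]
  refine (norm_add_le _ _).trans ?_
  rw [norm_mul, Complex.norm_real, Real.norm_of_nonneg (h0 n)]
  nlinarith [key n le_rfl, mul_le_mul_of_nonneg_left (hB n le_rfl) (h0 n)]

lemma cesaroNumber_eq (δ : ℝ) (n : ℕ) :
    cesaroNumber δ n = Real.Gamma (n + δ + 1) / (Real.Gamma (δ + 1) * Real.Gamma (n + 1)) := by
  rw [cesaroNumber, realBinom, add_sub_cancel_right]

lemma cesaroNumber_sub_one_eq (δ : ℝ) (n : ℕ) :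
    cesaroNumber (δ - 1) n = Real.Gamma (n + δ) / (Real.Gamma δ * Real.Gamma (n + 1)) := by
  rw [cesaroNumber_eq]
  congr 2 <;> ring_nf

lemma cesaroNumber_pos {δ : ℝ} (hδ : -1 < δ) (n : ℕ) : 0 < cesaroNumber δ n := by
  have hn : (0 : ℝ) ≤ n := n.cast_nonneg
  rw [cesaroNumber_eq]
  exact div_pos (Real.Gamma_pos_of_pos (by linarith))
    (mul_pos (Real.Gamma_pos_of_pos (by linarith)) (Real.Gamma_pos_of_pos (by linarith)))

lemma cesaroNumber_zero {δ : ℝ} (hδ : -1 < δ) : cesaroNumber δ 0 = 1 := by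
  have h := (Real.Gamma_pos_of_pos (by linarith : 0 < δ + 1)).ne'
  rw [cesaroNumber_eq]
  simp [h]

lemma cesaroNumber_succ {δ : ℝ} (hδ : -1 < δ) (n : ℕ) :
    cesaroNumber δ (n + 1) = (n + 1 + δ) / (n + 1) * cesaroNumber δ n := by
  have hn : (0 : ℝ) ≤ n := n.cast_nonneg
  have h1 := (Real.Gamma_pos_of_pos (by linarith : 0 < δ + 1)).ne'
  have h2 := (Real.Gamma_pos_of_pos (by linarith : 0 < (n : ℝ) + 1)).ne'
  have h3 : (n : ℝ) + 1 ≠ 0 := by linarith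
  rw [cesaroNumber_eq, cesaroNumber_eq, Nat.cast_succ, Real.Gamma_add_one h3,
    show (n : ℝ) + 1 + δ + 1 = (n + δ + 1) + 1 by ring, Real.Gamma_add_one (by linarith)]
  field_simp
  ring

lemma cesaroNumber_sub_one {δ : ℝ} (hδ : 0 < δ) (n : ℕ) :
    cesaroNumber (δ - 1) n = δ / (n + δ) * cesaroNumber δ n := by
  have hn : (0 : ℝ) ≤ n := n.cast_nonneg
  have h1 := (Real.Gamma_pos_of_pos hδ).ne'
  have h2 := (Real.Gamma_pos_of_pos (by linarith : 0 < (n : ℝ) + 1)).ne'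
  have h3 : (n : ℝ) + δ ≠ 0 := by linarith
  rw [cesaroNumber_sub_one_eq, cesaroNumber_eq, Real.Gamma_add_one hδ.ne', Real.Gamma_add_one h3]
  field_simp

lemma sum_cesaroNumber {δ : ℝ} (hδ : 0 < δ) (n : ℕ) :
    ∑ k ∈ range (n + 1), cesaroNumber (δ - 1) k = cesaroNumber δ n := by
  induction n with
  | zero => simp [cesaroNumber_zero (by linarith : -1 < δ),
      cesaroNumber_zero (by linarith : -1 < δ - 1)]
  | succ n ih =>
    have hn : (0 : ℝ) ≤ n := n.cast_nonneg
    have h3 : (n : ℝ) + 1 + δ ≠ 0 := by linarith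
    rw [sum_range_succ, ih, cesaroNumber_sub_one hδ, cesaroNumber_succ (by linarith), Nat.cast_succ]
    field_simp

lemma sum_cesaroNumber_reflect {δ : ℝ} (hδ : 0 < δ) (n : ℕ) :
    ∑ k ∈ range (n + 1), cesaroNumber (δ - 1) (n - k) = cesaroNumber δ n := by
  rw [← sum_cesaroNumber hδ, ← sum_range_reflect _ (n + 1)]
  refine sum_congr rfl fun k hk => ?_
  have := mem_range.1 hk
  congr 1
  omega

lemma antitone_cesaroNumber {δ : ℝ} (h0 : 0 < δ) (h1 : δ ≤ 1) :
    Antitone (cesaroNumber (δ - 1)) := by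
  refine antitone_nat_of_succ_le fun n => ?_
  rw [cesaroNumber_succ (by linarith)]
  refine mul_le_of_le_one_left (cesaroNumber_pos (by linarith) n).le ?_
  rw [div_le_one (by positivity)]
  linarith

lemma monotone_cesaroNumber {δ : ℝ} (h1 : 1 ≤ δ) : Monotone (cesaroNumber (δ - 1)) := by
  refine monotone_nat_of_le_succ fun n => ?_
  rw [cesaroNumber_succ (by linarith)]
  refine le_mul_of_one_le_left (cesaroNumber_pos (by linarith) n).le ?_
  rw [one_le_div (by positivity)]
  linarith

lemma rpow_le_cesaroNumber {δ : ℝ} (h0 : 0 < δ) (h1 : δ ≤ 1) (n : ℕ) :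
    ((n : ℝ) + 1) ^ δ ≤ cesaroNumber δ n := by
  induction n with
  | zero => simp [cesaroNumber_zero (by linarith : -1 < δ)]
  | succ n ih =>
    have hn : (0 : ℝ) < n + 1 := by positivity
    have hb := rpow_one_add_le_one_add_mul_self (s := 1 / ((n : ℝ) + 1))
      (by have := one_div_pos.2 hn; linarith) h0.le h1
    have e1 : 1 + 1 / ((n : ℝ) + 1) = (n + 1 + 1) / (n + 1) := by field_simp
    have e2 : 1 + δ * (1 / ((n : ℝ) + 1)) = (n + 1 + δ) / (n + 1) := by field_simp
    rw [e1, e2, Real.div_rpow (by positivity) hn.le] at hb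
    rw [cesaroNumber_succ (by linarith), Nat.cast_succ]
    calc ((n : ℝ) + 1 + 1) ^ δ = (n + 1 + 1) ^ δ / (n + 1) ^ δ * (n + 1) ^ δ := by
          field_simp
      _ ≤ _ := mul_le_mul hb ih (by positivity) (by positivity)

/-- The logarithmic convexity of the Gamma function bounds the Cesàro numbers from above. -/
lemma cesaroNumber_le {δ : ℝ} (h0 : 0 < δ) (h1 : δ < 1) (n : ℕ) :
    cesaroNumber δ n ≤ (Real.Gamma (δ + 1))⁻¹ * ((n : ℝ) + 1) ^ δ := by
  have hn : (0 : ℝ) < n + 1 := by positivity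
  have hG := Real.Gamma_pos_of_pos hn
  have hD := Real.Gamma_pos_of_pos (by linarith : 0 < δ + 1)
  have h := Real.Gamma_mul_add_mul_le_rpow_Gamma_mul_rpow_Gamma hn (by linarith : 0 < (n : ℝ) + 1 + 1)
    (by linarith : 0 < 1 - δ) h0 (by ring)
  rw [Real.Gamma_add_one hn.ne', Real.mul_rpow hn.le hG.le] at h
  have e : Real.Gamma ((n : ℝ) + 1) ^ (1 - δ) * (((n : ℝ) + 1) ^ δ * Real.Gamma (n + 1) ^ δ) =
      (n + 1) ^ δ * Real.Gamma (n + 1) := by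
    rw [mul_left_comm, ← Real.rpow_add hG]
    simp
  rw [e, show (1 - δ) * ((n : ℝ) + 1) + δ * (n + 1 + 1) = n + δ + 1 by ring] at h
  rw [cesaroNumber_eq, div_le_iff₀ (by positivity)]
  calc _ ≤ _ := h
    _ = _ := by field_simp

/-- The exponential sum with Cesàro weights has size `|1 - z| ^ (-δ)`: the terms of index up to
`1 / |1 - z|` are bounded trivially, the others by Abel's inequality. -/
lemma exists_norm_sum_cesaroNumber_mul_pow_le {δ : ℝ} (h0 : 0 < δ) (h1 : δ < 1) :
    ∃ C, 0 < C ∧ ∀ (n : ℕ) (z : ℂ), ‖z‖ = 1 →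
      ‖1 - z‖ * ‖∑ k ∈ range n, (cesaroNumber (δ - 1) k : ℂ) * z ^ k‖ ≤ C * ‖1 - z‖ ^ (1 - δ) := by
  have hD : 0 < (Real.Gamma (δ + 1))⁻¹ := inv_pos.2 (Real.Gamma_pos_of_pos (by linarith))
  set D := (Real.Gamma (δ + 1))⁻¹
  have hpos (k : ℕ) : 0 < cesaroNumber (δ - 1) k := cesaroNumber_pos (by linarith) k
  have htriv (m : ℕ) (z : ℂ) (hz : ‖z‖ = 1) :
      ‖∑ k ∈ range m, (cesaroNumber (δ - 1) k : ℂ) * z ^ k‖ ≤ D * (m : ℝ) ^ δ := by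
    cases m with
    | zero => simp [Real.zero_rpow h0.ne']
    | succ m =>
      refine (norm_sum_le _ _).trans ?_
      refine le_trans (le_of_eq ?_) ((cesaroNumber_le h0 h1 m).trans_eq (by rw [Nat.cast_succ]))
      rw [← sum_cesaroNumber h0]
      refine sum_congr rfl fun k _ => ?_
      rw [norm_mul, norm_pow, hz, one_pow, mul_one, Complex.norm_real,
        Real.norm_of_nonneg (hpos k).le]
  refine ⟨5 * D, by positivity, fun n z hz => ?_⟩
  set d := ‖1 - z‖ with hd
  rcases (norm_nonneg (1 - z)).eq_or_lt with hd0 | hd0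
  · rw [← hd] at hd0
    rw [← hd0, zero_mul]
    positivity
  rw [← hd] at hd0
  have hd2 : d ≤ 2 := by
    refine (norm_sub_le _ _).trans ?_
    rw [hz, norm_one]; norm_num
  set M := ⌈1 / d⌉₊ with hM
  have hM0 : 0 < M := Nat.ceil_pos.2 (by positivity)
  have hM1 : 1 / d ≤ M := Nat.le_ceil _
  have hM2 : (M : ℝ) ≤ 3 / d := by
    refine (Nat.ceil_lt_add_one (by positivity)).le.trans ?_
    rw [div_add_one hd0.ne']
    gcongr
    linarith
  have hMpos : (0 : ℝ) < M := Nat.cast_pos.2 hM0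
  have hhead (m : ℕ) (hm : m ≤ M) :
      d * ‖∑ k ∈ range m, (cesaroNumber (δ - 1) k : ℂ) * z ^ k‖ ≤ 3 * D * d ^ (1 - δ) := by
    have h3 : (m : ℝ) ^ δ ≤ 3 * d ^ (-δ) := by
      calc (m : ℝ) ^ δ ≤ (3 / d) ^ δ := by
            gcongr
            exact (Nat.cast_le.2 hm).trans hM2
        _ = 3 ^ δ * d ^ (-δ) := by
            rw [Real.div_rpow (by norm_num) hd0.le, Real.rpow_neg hd0.le, div_eq_mul_inv]
        _ ≤ 3 ^ (1 : ℝ) * d ^ (-δ) := by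
            gcongr
            norm_num
        _ = _ := by rw [Real.rpow_one]
    calc _ ≤ d * (D * (3 * d ^ (-δ))) := by
          gcongr
          exact (htriv m z hz).trans (by gcongr)
      _ = 3 * D * (d ^ (1 : ℝ) * d ^ (-δ)) := by rw [Real.rpow_one]; ring
      _ = _ := by rw [← Real.rpow_add hd0]; rfl
  rcases le_total n M with hn | hn
  · refine (hhead n hn).trans ?_
    gcongr
    norm_num
  obtain ⟨l, rfl⟩ := Nat.exists_eq_add_of_le hn
  have htail : d * ‖∑ k ∈ range l, (cesaroNumber (δ - 1) (M + k) : ℂ) * z ^ (M + k)‖ ≤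
      2 * D * d ^ (1 - δ) := by
    have hgeom (m : ℕ) : ‖∑ k ∈ range m, z ^ (M + k)‖ ≤ 2 / d := by
      rw [le_div_iff₀ hd0, mul_comm, hd, ← norm_mul]
      simp only [pow_add, ← mul_sum]
      rw [mul_left_comm, mul_neg_geom_sum, norm_mul, norm_pow, hz, one_pow, one_mul]
      refine (norm_sub_le _ _).trans ?_
      rw [norm_pow, hz, one_pow, norm_one]; norm_num
    have hA := norm_sum_mul_le_of_antitone (c := fun k => cesaroNumber (δ - 1) (M + k))
      (fun a b hab => antitone_cesaroNumber h0 h1.le (by omega)) (fun k => (hpos _).le)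
      (n := l) (fun m _ => hgeom m)
    have hsmall : cesaroNumber (δ - 1) M ≤ D * d ^ (1 - δ) := by
      -- by monotonicity the weight is at most the mean of the preceding ones
      have hsum : (M : ℝ) * cesaroNumber (δ - 1) M ≤ D * (M : ℝ) ^ δ := by
        obtain ⟨m, hm⟩ := Nat.exists_eq_succ_of_ne_zero hM0.ne'
        have := cesaroNumber_le h0 h1 m
        rw [← sum_cesaroNumber h0, ← Nat.cast_succ, ← Nat.succ_eq_add_one, ← hm] at this
        refine le_trans ?_ this
        rw [← nsmul_eq_mul]
        convert card_nsmul_le_sum (range M) _ (cesaroNumber (δ - 1) M) ?_ using 2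
        · rw [card_range]
        · intro k hk
          exact antitone_cesaroNumber h0 h1.le (mem_range.1 hk).le
      calc cesaroNumber (δ - 1) M ≤ D * (M : ℝ) ^ δ / M := by
            rwa [le_div_iff₀ hMpos, mul_comm]
        _ = D * (M : ℝ) ^ (δ - 1) := by rw [Real.rpow_sub_one hMpos.ne']; ring
        _ ≤ D * (1 / d) ^ (δ - 1) := by
            refine mul_le_mul_of_nonneg_left ?_ hD.le
            exact Real.rpow_le_rpow_of_nonpos (by positivity) hM1 (by linarith)
        _ = _ := by
            rw [one_div, Real.inv_rpow hd0.le, ← Real.rpow_neg hd0.le, neg_sub]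
    calc _ ≤ d * (cesaroNumber (δ - 1) M * (2 / d)) := by
          gcongr
          exact hA
      _ = 2 * cesaroNumber (δ - 1) M := by field_simp
      _ ≤ _ := by linarith
  rw [sum_range_add]
  have := mul_le_mul_of_nonneg_left (norm_add_le
    (∑ k ∈ range M, (cesaroNumber (δ - 1) k : ℂ) * z ^ k)
    (∑ k ∈ range l, (cesaroNumber (δ - 1) (M + k) : ℂ) * z ^ (M + k))) hd0.le
  linarith [hhead M le_rfl]

lemma sum_cesaroNumber_reflect_mul_pow {δ : ℝ} (n : ℕ) {z : ℂ} (hz : ‖z‖ = 1) :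
    ‖∑ k ∈ range (n + 1), (cesaroNumber (δ - 1) (n - k) : ℂ) * z ^ k‖ =
      ‖∑ k ∈ range (n + 1), (cesaroNumber (δ - 1) k : ℂ) * z⁻¹ ^ k‖ := by
  have hz0 : z ≠ 0 := norm_ne_zero_iff.1 (by rw [hz]; exact one_ne_zero)
  have h : ∑ k ∈ range (n + 1), (cesaroNumber (δ - 1) (n - k) : ℂ) * z ^ k =
      z ^ n * ∑ k ∈ range (n + 1), (cesaroNumber (δ - 1) k : ℂ) * z⁻¹ ^ k := by
    rw [← sum_range_reflect _ (n + 1), mul_sum]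
    refine sum_congr rfl fun k hk => ?_
    have hk : k ≤ n := Nat.lt_succ_iff.1 (mem_range.1 hk)
    have e : z ^ n = z ^ (n - k) * z ^ k := by rw [← pow_add, Nat.sub_add_cancel hk]
    have e2 : n + 1 - 1 - k = n - k := by omega
    rw [e2, Nat.sub_sub_self hk, e, inv_pow]
    field_simp
  rw [h, norm_mul, norm_pow, hz, one_pow, one_mul]

/-! ### Pointwise bounds for the Cesàro kernel -/

/-- The kernel of the Cesàro mean `cesaroMean δ n`. -/
noncomputable def cesaroKernel (δ : ℝ) (n : ℕ) (t : plane) : ℂ :=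
  ((1 / cesaroNumber δ n : ℝ) : ℂ) *
    ∑ k ∈ range (n + 1), (cesaroNumber (δ - 1) (n - k) : ℂ) * dirichletKernel k t

/-- The power `|a| ^ (-r)`, frozen for `|a| ≤ ε`. -/
noncomputable def truncPow (ε r a : ℝ) : ℝ := (max |a| ε) ^ (-r)

lemma truncPow_nonneg {ε : ℝ} (r a : ℝ) : 0 ≤ truncPow ε r a :=
  Real.rpow_nonneg ((abs_nonneg a).trans (le_max_left _ _)) _

lemma truncPow_one_add_mul_abs_le {ε : ℝ} (hε : 0 < ε) (r a : ℝ) :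
    truncPow ε (1 + r) a * |a| ≤ truncPow ε r a := by
  have h : 0 < max |a| ε := hε.trans_le (le_max_right _ _)
  calc truncPow ε (1 + r) a * |a| ≤ truncPow ε (1 + r) a * max |a| ε :=
        mul_le_mul_of_nonneg_left (le_max_left _ _) (truncPow_nonneg _ _)
    _ = (max |a| ε) ^ (-(1 + r)) * (max |a| ε) ^ (1 : ℝ) := by rw [Real.rpow_one, truncPow]
    _ = truncPow ε r a := by rw [← Real.rpow_add h, truncPow]; ring_nf

lemma norm_cesaroKernel (δ : ℝ) (hδ : 0 < δ) (n : ℕ) (t : plane) :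
    ‖cesaroKernel δ n t‖ = (cesaroNumber δ n)⁻¹ *
      ‖∑ k ∈ range (n + 1), (cesaroNumber (δ - 1) (n - k) : ℂ) * dirichletKernel k t‖ := by
  rw [cesaroKernel, norm_mul, Complex.norm_real, Real.norm_of_nonneg, one_div]
  exact one_div_nonneg.2 (cesaroNumber_pos (by linarith) n).le

lemma norm_geom_sum_edgeExp_le {i : Fin 3} {t : plane} (ht : |edgeCoord i t| ≤ 2 / 3)
    {n m : ℕ} (hm : m ≤ n + 1) :
    ‖∑ k ∈ range m, edgeExp i t ^ k‖ ≤ 2 * truncPow ((n : ℝ) + 1)⁻¹ 1 (edgeCoord i t) := by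
  have hn : (0 : ℝ) < (n : ℝ) + 1 := by positivity
  have hz := norm_edgeExp i t
  rw [truncPow, Real.rpow_neg_one]
  rcases le_total |edgeCoord i t| ((n : ℝ) + 1)⁻¹ with h | h
  · rw [max_eq_right h, inv_inv]
    refine (norm_sum_le _ _).trans ?_
    simp only [norm_pow, hz, one_pow, sum_const, card_range, nsmul_eq_mul, mul_one]
    have : (m : ℝ) ≤ n + 1 := by exact_mod_cast hm
    linarith
  · rw [max_eq_left h, ← div_eq_mul_inv]
    have h0 : 0 < |edgeCoord i t| := (inv_pos.2 hn).trans_le h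
    rw [le_div_iff₀ h0]
    calc _ ≤ ‖∑ k ∈ range m, edgeExp i t ^ k‖ * ‖1 - edgeExp i t‖ :=
          mul_le_mul_of_nonneg_left (abs_edgeCoord_le_norm ht) (norm_nonneg _)
      _ = ‖1 - edgeExp i t ^ m‖ := by rw [← norm_mul, mul_comm, mul_neg_geom_sum]
      _ ≤ 2 := by
        refine (norm_sub_le _ _).trans ?_
        rw [norm_pow, hz, one_pow, norm_one]; norm_num

/-- For `δ ≥ 1` the weights are monotone, so Abel's inequality reduces the Cesàro kernel to the
factorized kernels `∑_{k ≤ m} D_k`. -/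
lemma norm_cesaroKernel_le_prod {δ : ℝ} (hδ : 1 ≤ δ) (n : ℕ) {t : plane}
    (ht : ∀ i, |edgeCoord i t| ≤ 2 / 3) :
    ‖cesaroKernel δ n t‖ ≤
      8 * δ / (n + 1) * ∏ i, truncPow ((n : ℝ) + 1)⁻¹ 1 (edgeCoord i t) := by
  have hA := cesaroNumber_pos (by linarith : -1 < δ) n
  have h := norm_sum_mul_le_of_antitone (c := fun k => cesaroNumber (δ - 1) (n - k))
    (fun a b hab => monotone_cesaroNumber hδ (by omega))
    (fun k => (cesaroNumber_pos (by linarith) _).le)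
    (d := fun k => dirichletKernel k t) (n := n + 1)
    (B := ∏ i, 2 * truncPow ((n : ℝ) + 1)⁻¹ 1 (edgeCoord i t)) (fun m hm => by
      rw [sum_dirichletKernel, norm_prod]
      exact prod_le_prod (fun _ _ => norm_nonneg _) fun i _ => norm_geom_sum_edgeExp_le (ht i) hm)
  rw [prod_mul_distrib, prod_const, card_univ, Fintype.card_fin] at h
  rw [norm_cesaroKernel δ (by linarith)]
  have hP : 0 ≤ ∏ i, truncPow ((n : ℝ) + 1)⁻¹ 1 (edgeCoord i t) :=
    prod_nonneg fun _ _ => truncPow_nonneg _ _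
  calc _ ≤ (cesaroNumber δ n)⁻¹ * _ := mul_le_mul_of_nonneg_left h (inv_nonneg.2 hA.le)
    _ = 8 * (δ / (n + δ)) * ∏ i, truncPow ((n : ℝ) + 1)⁻¹ 1 (edgeCoord i t) := by
      rw [Nat.sub_zero, cesaroNumber_sub_one (by linarith)]
      field_simp
      ring
    _ ≤ _ := by
      rw [mul_div_assoc]
      gcongr

/-- Bounds for the Cesàro kernel with `δ ≥ 1` by products of functions of two edge coordinates. -/
lemma norm_cesaroKernel_le_of_one_le {δ : ℝ} (hδ : 1 ≤ δ) (n : ℕ) {t : plane}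
    (ht : ∀ i, |edgeCoord i t| ≤ 2 / 3) : ∃ i j : Fin 3, i ≠ j ∧
      ‖cesaroKernel δ n t‖ ≤ 16 * δ / (n + 1) *
        (truncPow ((n : ℝ) + 1)⁻¹ (3 / 2) (edgeCoord i t) *
          truncPow ((n : ℝ) + 1)⁻¹ (3 / 2) (edgeCoord j t)) ∧
      ‖cesaroKernel δ n t‖ * ‖t‖ ≤ 32 * δ / (n + 1) *
        (truncPow ((n : ℝ) + 1)⁻¹ 1 (edgeCoord i t) *
          truncPow ((n : ℝ) + 1)⁻¹ 1 (edgeCoord j t)) := by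
  obtain ⟨i, j, k, hij, hprod, h1, h2, h3⟩ := exists_extremal_edgeCoord t
  refine ⟨i, j, hij, ?_⟩
  have hK := norm_cesaroKernel_le_prod hδ n ht
  have htX := norm_le_of_abs_edgeCoord_le h2
  rw [hprod fun i => truncPow ((n : ℝ) + 1)⁻¹ 1 (edgeCoord i t)] at hK
  have hε : 0 < ((n : ℝ) + 1)⁻¹ := by positivity
  simp only [truncPow] at hK ⊢
  set ε := ((n : ℝ) + 1)⁻¹
  set x := max |edgeCoord i t| ε
  set X := max |edgeCoord j t| ε with hX
  set y := max |edgeCoord k t| ε with hy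
  have hx0 : 0 < x := hε.trans_le (le_max_right _ _)
  have hX0 : 0 < X := hε.trans_le (le_max_right _ _)
  have hy0 : 0 < y := hε.trans_le (le_max_right _ _)
  have hxX : x ≤ X := max_le_max_right _ h1
  have hXy : X ≤ 2 * y := by
    refine max_le (h3.trans ?_) ?_
    · linarith [le_max_left |edgeCoord k t| ε]
    · linarith [le_max_right |edgeCoord k t| ε]
  have hsX : |edgeCoord j t| ≤ X := le_max_left _ _
  have hyX : y ^ (-1 : ℝ) ≤ 2 * X ^ (-1 : ℝ) := by
    rw [Real.rpow_neg_one, Real.rpow_neg_one, ← div_eq_mul_inv, inv_le_comm₀ hy0 (by positivity),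
      inv_div]
    linarith
  have hK2 : ‖cesaroKernel δ n t‖ ≤
      16 * δ / (n + 1) * (x ^ (-1 : ℝ) * (X ^ (-1 : ℝ) * X ^ (-1 : ℝ))) := by
    refine hK.trans ?_
    calc _ ≤ 8 * δ / (n + 1) * (x ^ (-1 : ℝ) * X ^ (-1 : ℝ) * (2 * X ^ (-1 : ℝ))) := by gcongr
      _ = _ := by ring
  refine ⟨hK2.trans ?_, ?_⟩
  · refine mul_le_mul_of_nonneg_left ?_ (by positivity)
    calc x ^ (-1 : ℝ) * (X ^ (-1 : ℝ) * X ^ (-1 : ℝ))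
        = x ^ (-1 : ℝ) * (X ^ (-(1 / 2) : ℝ) * X ^ (-(3 / 2) : ℝ)) := by
          rw [← Real.rpow_add hX0, ← Real.rpow_add hX0]; norm_num
      _ ≤ x ^ (-1 : ℝ) * (x ^ (-(1 / 2) : ℝ) * X ^ (-(3 / 2) : ℝ)) := by
          gcongr ?_ * (?_ * ?_)
          exact Real.rpow_le_rpow_of_nonpos hx0 hxX (by norm_num)
      _ = x ^ (-(3 / 2) : ℝ) * X ^ (-(3 / 2) : ℝ) := by
          rw [← mul_assoc, ← Real.rpow_add hx0]; norm_num
  · calc _ ≤ 16 * δ / (n + 1) * (x ^ (-1 : ℝ) * (X ^ (-1 : ℝ) * X ^ (-1 : ℝ))) * (2 * X) := by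
          gcongr
          exact htX.trans (by linarith)
      _ = _ := by
          rw [Real.rpow_neg_one, Real.rpow_neg_one]
          field_simp
          ring

lemma norm_cesaroKernel_le_sq {δ : ℝ} (h0 : 0 < δ) (n : ℕ) (t : plane) :
    ‖cesaroKernel δ n t‖ ≤ 4 * ((n : ℝ) + 1) ^ 2 := by
  have hA := cesaroNumber_pos (by linarith : -1 < δ) n
  rw [norm_cesaroKernel δ h0, inv_mul_le_iff₀ hA, ← sum_cesaroNumber_reflect h0, sum_mul]
  refine (norm_sum_le _ _).trans (sum_le_sum fun k hk => ?_)
  have ha := cesaroNumber_pos (by linarith : -1 < δ - 1) (n - k)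
  rw [norm_mul, Complex.norm_real, Real.norm_of_nonneg ha.le]
  refine mul_le_mul_of_nonneg_left ((norm_dirichletKernel_le k t).trans ?_) ha.le
  have : (k : ℝ) ≤ n := Nat.cast_le.2 (Nat.lt_succ_iff.1 (mem_range.1 hk))
  gcongr

/-- The three-term closed form of the Dirichlet kernel, summed with the Cesàro weights. -/
lemma exists_prod_mul_norm_cesaroKernel_le {δ : ℝ} (h0 : 0 < δ) (h1 : δ < 1) :
    ∃ C, 0 < C ∧ ∀ (n : ℕ) (t : plane), (∏ i, ‖1 - edgeExp i t‖) * ‖cesaroKernel δ n t‖ ≤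
      C * ((n : ℝ) + 1) ^ (-δ) * ∑ i, ‖1 - edgeExp i t‖ ^ (1 - δ) := by
  obtain ⟨C, hC, h⟩ := exists_norm_sum_cesaroNumber_mul_pow_le h0 h1
  refine ⟨2 * C, by positivity, fun n t => ?_⟩
  have hN : (0 : ℝ) < (n : ℝ) + 1 := by positivity
  have hsum : (∏ i, (1 - edgeExp i t)) *
      ∑ k ∈ range (n + 1), (cesaroNumber (δ - 1) (n - k) : ℂ) * dirichletKernel k t =
      ∑ i, (1 - edgeExp i t) *
        (∑ k ∈ range (n + 1), (cesaroNumber (δ - 1) (n - k) : ℂ) * edgeExp i t ^ k +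
          (edgeExp i t)⁻¹ *
          ∑ k ∈ range (n + 1), (cesaroNumber (δ - 1) (n - k) : ℂ) * (edgeExp i t)⁻¹ ^ k) := by
    simp only [mul_sum, ← sum_add_distrib]
    rw [sum_comm]
    refine sum_congr rfl fun k _ => ?_
    rw [mul_left_comm, prod_one_sub_mul_dirichletKernel, mul_sum]
    refine sum_congr rfl fun i _ => ?_
    ring
  have hinv (i : Fin 3) : ‖1 - (edgeExp i t)⁻¹‖ = ‖1 - edgeExp i t‖ := by
    have hz : edgeExp i t ≠ 0 := Complex.exp_ne_zero _
    have e : 1 - (edgeExp i t)⁻¹ = -((edgeExp i t)⁻¹ * (1 - edgeExp i t)) := by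
      field_simp; ring
    rw [e, norm_neg, norm_mul, norm_inv, norm_edgeExp, inv_one, one_mul]
  have hbd : (∏ i, ‖1 - edgeExp i t‖) *
      ‖∑ k ∈ range (n + 1), (cesaroNumber (δ - 1) (n - k) : ℂ) * dirichletKernel k t‖ ≤
      2 * C * ∑ i, ‖1 - edgeExp i t‖ ^ (1 - δ) := by
    rw [← norm_prod, ← norm_mul, hsum, mul_sum]
    refine (norm_sum_le _ _).trans (sum_le_sum fun i _ => ?_)
    have hz := norm_edgeExp i t
    have hz' : ‖(edgeExp i t)⁻¹‖ = 1 := by rw [norm_inv, hz, inv_one]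
    have e1 := h (n + 1) _ hz'
    have e2 := h (n + 1) _ hz
    rw [hinv, ← sum_cesaroNumber_reflect_mul_pow n hz] at e1
    rw [← inv_inv (edgeExp i t), ← sum_cesaroNumber_reflect_mul_pow n hz', inv_inv] at e2
    rw [norm_mul]
    have e3 := norm_add_le
      (∑ k ∈ range (n + 1), (cesaroNumber (δ - 1) (n - k) : ℂ) * edgeExp i t ^ k)
      ((edgeExp i t)⁻¹ *
        ∑ k ∈ range (n + 1), (cesaroNumber (δ - 1) (n - k) : ℂ) * (edgeExp i t)⁻¹ ^ k)
    rw [norm_mul, hz', one_mul] at e3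
    nlinarith [mul_le_mul_of_nonneg_left e3 (norm_nonneg (1 - edgeExp i t))]
  have hinvA : (cesaroNumber δ n)⁻¹ ≤ ((n : ℝ) + 1) ^ (-δ) := by
    rw [Real.rpow_neg hN.le]
    exact inv_anti₀ (by positivity) (rpow_le_cesaroNumber h0 h1.le n)
  rw [norm_cesaroKernel δ h0, mul_left_comm]
  calc _ ≤ ((n : ℝ) + 1) ^ (-δ) * (2 * C * ∑ i, ‖1 - edgeExp i t‖ ^ (1 - δ)) :=
        mul_le_mul hinvA hbd (by positivity) (by positivity)
    _ = _ := by ring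

/-- Bounds for the Cesàro kernel with `δ < 1` by products of functions of two edge coordinates.
Near the lines where an edge coordinate vanishes the trivial bound by `n²` is used instead of the
cancellation of the three terms of the kernel, which costs only a constant factor in the
logarithm. -/
lemma exists_norm_cesaroKernel_le_of_lt_one {δ : ℝ} (h0 : 0 < δ) (h1 : δ < 1) :
    ∃ C, 0 < C ∧ ∀ (n : ℕ) (t : plane), (∀ i, |edgeCoord i t| ≤ 2 / 3) →
      ∃ i j : Fin 3, i ≠ j ∧
        ‖cesaroKernel δ n t‖ ≤ C * ((n : ℝ) + 1) ^ (-δ) *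
          (truncPow ((n : ℝ) + 1)⁻¹ (1 + δ) (edgeCoord i t) *
            truncPow (((n : ℝ) + 1) ^ 3)⁻¹ 1 (edgeCoord j t)) ∧
        ‖cesaroKernel δ n t‖ * ‖t‖ ≤ 2 * C * ((n : ℝ) + 1) ^ (-δ) *
          (truncPow ((n : ℝ) + 1)⁻¹ δ (edgeCoord i t) *
            truncPow (((n : ℝ) + 1) ^ 3)⁻¹ 1 (edgeCoord j t)) := by
  obtain ⟨C, hC, h⟩ := exists_prod_mul_norm_cesaroKernel_le h0 h1
  refine ⟨42 * C + 4, by positivity, fun n t ht => ?_⟩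
  obtain ⟨i, j, k, hij, hprod, e1, e2, e3⟩ := exists_extremal_edgeCoord t
  have htX := norm_le_of_abs_edgeCoord_le e2
  set N : ℝ := (n : ℝ) + 1 with hN
  have hN1 : 1 ≤ N := by rw [hN]; linarith [(Nat.cast_nonneg n : (0 : ℝ) ≤ n)]
  have hN0 : 0 < N := by linarith
  have hK0 := norm_nonneg (cesaroKernel δ n t)
  have hK1 := norm_cesaroKernel_le_sq h0 n t
  have hK2 := h n t
  set κ := ‖cesaroKernel δ n t‖
  have hmain : κ ≤ (42 * C + 4) * N ^ (-δ) *
      (truncPow N⁻¹ (1 + δ) (edgeCoord j t) * truncPow (N ^ 3)⁻¹ 1 (edgeCoord i t)) := by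
    have hX1 := ht j
    have hx1 : 0 ≤ |edgeCoord i t| := abs_nonneg _
    have hlow : |edgeCoord i t| * |edgeCoord j t| * |edgeCoord k t| ≤
        ∏ i, ‖1 - edgeExp i t‖ := by
      rw [← hprod fun i => |edgeCoord i t|]
      exact prod_le_prod (fun _ _ => abs_nonneg _) fun i _ => abs_edgeCoord_le_norm (ht i)
    have hup (l : Fin 3) : ‖1 - edgeExp l t‖ ^ (1 - δ) ≤ 7 * |edgeCoord j t| ^ (1 - δ) := by
      calc _ ≤ (7 * |edgeCoord j t|) ^ (1 - δ) := by
            refine Real.rpow_le_rpow (norm_nonneg _) ?_ (by linarith)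
            linarith [norm_le_abs_edgeCoord l t, e2 l]
        _ = 7 ^ (1 - δ) * |edgeCoord j t| ^ (1 - δ) :=
            Real.mul_rpow (by norm_num) (abs_nonneg _)
        _ ≤ 7 ^ (1 : ℝ) * |edgeCoord j t| ^ (1 - δ) := by
            gcongr
            · norm_num
            · linarith
        _ = _ := by rw [Real.rpow_one]
    have hsum : ∑ l, ‖1 - edgeExp l t‖ ^ (1 - δ) ≤ 21 * |edgeCoord j t| ^ (1 - δ) := by
      rw [Fin.sum_univ_three]
      linarith [hup 0, hup 1, hup 2]
    set x := |edgeCoord i t|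
    set X := |edgeCoord j t| with hX
    set y := |edgeCoord k t|
    have hx0 : 0 ≤ x := abs_nonneg _
    have hX0 : 0 ≤ X := abs_nonneg _
    have hbd : κ * (x * X ^ 2) ≤ 42 * C * N ^ (-δ) * X ^ (1 - δ) := by
      have a1 : x * X ^ 2 ≤ 2 * (x * X * y) := by nlinarith [mul_nonneg hx0 hX0]
      have a2 : κ * (x * X ^ 2) ≤ κ * (2 * ∏ i, ‖1 - edgeExp i t‖) :=
        mul_le_mul_of_nonneg_left (by linarith) hK0
      have a3 : C * N ^ (-δ) * ∑ l, ‖1 - edgeExp l t‖ ^ (1 - δ) ≤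
          C * N ^ (-δ) * (21 * X ^ (1 - δ)) := mul_le_mul_of_nonneg_left hsum (by positivity)
      linarith
    have hm1 : 0 < max X N⁻¹ := (inv_pos.2 hN0).trans_le (le_max_right _ _)
    have hm2 : 0 < max x (N ^ 3)⁻¹ := lt_of_lt_of_le (by positivity) (le_max_right _ _)
    have hgoal : κ * (N ^ δ * (max X N⁻¹) ^ (1 + δ) * max x (N ^ 3)⁻¹) ≤ 42 * C + 4 := by
      rcases le_total X N⁻¹ with hcase | hcase
      · have hxN : max x (N ^ 3)⁻¹ ≤ N⁻¹ := by
          refine max_le (e1.trans hcase) (inv_anti₀ hN0 ?_)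
          nlinarith [sq_nonneg N, mul_nonneg hN0.le (sub_nonneg.2 hN1)]
        rw [max_eq_right hcase]
        calc _ ≤ 4 * N ^ 2 * (N ^ δ * N⁻¹ ^ (1 + δ) * N⁻¹) := by gcongr
          _ = 4 := by
            rw [Real.inv_rpow hN0.le, Real.rpow_add hN0, Real.rpow_one]
            have : N ^ δ ≠ 0 := (Real.rpow_pos_of_pos hN0 _).ne'
            field_simp
          _ ≤ _ := by linarith
      have hXpos : 0 < X := (inv_pos.2 hN0).trans_le hcase
      rw [max_eq_left hcase]
      rcases le_total x (N ^ 3)⁻¹ with hcase' | hcase'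
      · rw [max_eq_right hcase']
        have b1 : X ^ (1 + δ) ≤ 1 := Real.rpow_le_one hX0 (by linarith) (by linarith)
        have b2 : N ^ δ ≤ N := by
          calc N ^ δ ≤ N ^ (1 : ℝ) := Real.rpow_le_rpow_of_exponent_le hN1 h1.le
            _ = N := Real.rpow_one N
        calc _ ≤ 4 * N ^ 2 * (N * 1 * (N ^ 3)⁻¹) := by gcongr
          _ = 4 := by field_simp
          _ ≤ _ := by linarith
      · rw [max_eq_left hcase']
        have b1 : X ^ (1 + δ) = X ^ 2 * X ^ (δ - 1) := by
          rw [← Real.rpow_natCast X 2, ← Real.rpow_add hXpos]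
          congr 1
          push_cast
          ring
        have b2 : X ^ (1 - δ) * X ^ (δ - 1) = 1 := by
          rw [← Real.rpow_add hXpos]; simp
        have b3 : N ^ (-δ) * N ^ δ = 1 := by
          rw [← Real.rpow_add hN0]; simp
        calc κ * (N ^ δ * X ^ (1 + δ) * x) = κ * (x * X ^ 2) * (N ^ δ * X ^ (δ - 1)) := by
              rw [b1]; ring
          _ ≤ 42 * C * N ^ (-δ) * X ^ (1 - δ) * (N ^ δ * X ^ (δ - 1)) := by gcongr
          _ = 42 * C * (N ^ (-δ) * N ^ δ) * (X ^ (1 - δ) * X ^ (δ - 1)) := by ring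
          _ ≤ _ := by rw [b2, b3]; linarith
    have hD : 0 < N ^ δ * (max X N⁻¹) ^ (1 + δ) * max x (N ^ 3)⁻¹ := by positivity
    have := (le_div_iff₀ hD).2 hgoal
    refine this.trans_eq ?_
    rw [truncPow, truncPow, Real.rpow_neg hN0.le, Real.rpow_neg hm1.le, Real.rpow_neg_one]
    field_simp
    rfl
  refine ⟨j, i, hij.symm, hmain, ?_⟩
  have hq := truncPow_one_add_mul_abs_le (inv_pos.2 hN0) δ (edgeCoord j t)
  have hp : 0 ≤ truncPow (N ^ 3)⁻¹ 1 (edgeCoord i t) := truncPow_nonneg _ _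
  have hq0 : 0 ≤ truncPow N⁻¹ (1 + δ) (edgeCoord j t) := truncPow_nonneg _ _
  calc _ ≤ (42 * C + 4) * N ^ (-δ) *
      (truncPow N⁻¹ (1 + δ) (edgeCoord j t) * truncPow (N ^ 3)⁻¹ 1 (edgeCoord i t)) *
        (2 * |edgeCoord j t|) := by gcongr
    _ = 2 * (42 * C + 4) * N ^ (-δ) * (truncPow N⁻¹ (1 + δ) (edgeCoord j t) * |edgeCoord j t| *
        truncPow (N ^ 3)⁻¹ 1 (edgeCoord i t)) := by ring
    _ ≤ _ := by gcongr

/-! ### Convolution with the Cesàro kernel -/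

lemma continuous_expChar (j : Fin 3 → ℤ) : Continuous (expChar j) := by
  have h : Continuous fun t : plane => ∑ i, (j i : ℝ) * t.1 i :=
    continuous_finsetSum _ fun i _ => continuous_const.mul (continuous_coord i)
  exact Complex.continuous_exp.comp (continuous_const.mul (Complex.continuous_ofReal.comp h))

lemma expChar_add (j : Fin 3 → ℤ) (s t : plane) :
    expChar j (s + t) = expChar j s * expChar j t := by
  rw [expChar, expChar, expChar, ← Complex.exp_add, ← mul_add, ← Complex.ofReal_add,
    ← sum_add_distrib]
  congr 3
  exact sum_congr rfl fun i _ => mul_add (j i : ℝ) (s.1 i) (t.1 i)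

lemma expChar_zero (j : Fin 3 → ℤ) : expChar j 0 = 1 := by
  simp [expChar]

lemma conj_expChar (j : Fin 3 → ℤ) (t : plane) :
    (starRingEnd ℂ) (expChar j t) = expChar j (-t) := by
  have h : expChar j t * expChar j (-t) = 1 := by
    rw [← expChar_add, add_neg_cancel, expChar_zero]
  rw [← Complex.inv_eq_conj (norm_expChar j t)]
  exact inv_eq_of_mul_eq_one_right h

lemma hPeriodic_expChar {j : Fin 3 → ℤ} (hj : j 0 + j 1 + j 2 = 0) : HPeriodic (expChar j) := by
  rintro s ⟨⟨a, ha⟩, ⟨b, hb⟩⟩ t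
  have hs := plane_sum_eq_zero s
  have hj' : (j 0 + j 1 + j 2 : ℝ) = 0 := by exact_mod_cast hj
  simp only [ZeroMemClass.coe_zero, Pi.zero_apply, sub_zero] at ha hb
  have h1 : ∑ i, (j i : ℝ) * s.1 i = 3 * ((j 0 * (a + b) + j 1 * b : ℤ) : ℝ) := by
    rw [Fin.sum_univ_three]
    push_cast
    linear_combination (j 0 : ℝ) * ha + (j 0 + j 1 : ℝ) * hb + s.1 2 * hj'
  have h2 : expChar j s = 1 := by
    rw [expChar, h1, ← Complex.exp_int_mul_two_pi_mul_I (j 0 * (a + b) + j 1 * b)]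
    congr 1
    push_cast
    ring
  rw [expChar_add, h2, mul_one]

lemma sum_eq_zero_of_mem_hexIndex {n : ℕ} {j : Fin 3 → ℤ} (hj : j ∈ hexIndex n) :
    j 0 + j 1 + j 2 = 0 := (mem_filter.1 hj).2

/-- A nontrivial character takes a value different from `1` at some translation, which leaves its
integral over the hexagon invariant. -/
lemma setIntegral_expChar_eq_zero {j : Fin 3 → ℤ} (hj : j 0 + j 1 + j 2 = 0) (h0 : j ≠ 0) :
    ∫ t in hexagon, expChar j t ∂planeMeasure = 0 := by
  have hj' : (j 0 + j 1 + j 2 : ℝ) = 0 := by exact_mod_cast hj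
  have hq : 0 < ∑ i, (j i : ℝ) * j i := by
    obtain ⟨i, hi⟩ := Function.ne_iff.1 h0
    refine sum_pos' (fun _ _ => mul_self_nonneg _) ⟨i, mem_univ _, ?_⟩
    exact mul_self_pos.2 (Int.cast_ne_zero.2 hi)
  set q := ∑ i, (j i : ℝ) * j i with hqdef
  -- at `x = (3 / (2 |j|²)) j` the character equals `-1`
  let x : plane := ⟨fun i => 3 / (2 * q) * j i, by
    change 3 / (2 * q) * (j 0 : ℝ) + 3 / (2 * q) * j 1 + 3 / (2 * q) * j 2 = 0
    rw [← mul_add, ← mul_add, hj', mul_zero]⟩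
  have hx : expChar j x = -1 := by
    have : ∑ i, (j i : ℝ) * x.1 i = 3 / 2 := by
      have e : ∑ i, (j i : ℝ) * x.1 i = 3 / (2 * q) * q := by
        rw [hqdef, mul_sum]
        exact sum_congr rfl fun i _ => by
          change (j i : ℝ) * (3 / (2 * q) * j i) = _
          ring
      rw [e]
      field_simp
    rw [expChar, this, ← Complex.exp_pi_mul_I]
    congr 1
    push_cast
    ring
  have h := (hPeriodic_expChar hj).setIntegral_add_left x
  simp only [expChar_add, hx] at h
  rw [integral_const_mul] at h
  linear_combination -(1 / 2) * h

lemma continuous_dirichletKernel (n : ℕ) : Continuous (dirichletKernel n) :=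
  continuous_finsetSum _ fun j _ => continuous_expChar j

lemma continuous_cesaroKernel (δ : ℝ) (n : ℕ) : Continuous (cesaroKernel δ n) := by
  have := continuous_dirichletKernel
  unfold cesaroKernel
  fun_prop

lemma setIntegral_dirichletKernel_neg (n : ℕ) :
    ∫ t in hexagon, dirichletKernel n (-t) ∂planeMeasure = planeMeasure.real hexagon := by
  have hmem : (0 : Fin 3 → ℤ) ∈ hexIndex n := by
    simp [hexIndex]
  simp only [dirichletKernel, ← conj_expChar]
  have hint (j : Fin 3 → ℤ) :
      IntegrableOn (fun t => (starRingEnd ℂ) (expChar j t)) hexagon planeMeasure :=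
    integrableOn_hexagon (Complex.continuous_conj.comp (continuous_expChar j))
  rw [integral_finsetSum _ fun j _ => hint j]
  rw [sum_eq_single_of_mem 0 hmem]
  · simp [expChar]
  · intro j hj h0
    rw [integral_conj, setIntegral_expChar_eq_zero (sum_eq_zero_of_mem_hexIndex hj) h0, map_zero]

lemma partialSum_eq_setIntegral {f : plane → ℂ} (hc : Continuous f) (hf : HPeriodic f) (n : ℕ)
    (x : plane) : partialSum n f x = (((planeMeasure.real hexagon)⁻¹ : ℝ) : ℂ) *
      ∫ t in hexagon, f (x + t) * dirichletKernel n (-t) ∂planeMeasure := by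
  have hterm {j : Fin 3 → ℤ} (hj : j ∈ hexIndex n) : fourierCoeff f j * expChar j x =
      (((planeMeasure.real hexagon)⁻¹ : ℝ) : ℂ) *
        ∫ t in hexagon, f (x + t) * expChar j (-t) ∂planeMeasure := by
    have hg : HPeriodic fun t => f t * expChar j (x + -t) := by
      intro s hs t
      have h1 := hf s hs t
      have h2 := hPeriodic_expChar (sum_eq_zero_of_mem_hexIndex hj) s hs (x + -(t + s))
      rw [show x + -(t + s) + s = x + -t by abel] at h2
      change f (t + s) * expChar j (x + -(t + s)) = f t * expChar j (x + -t)
      rw [h1, h2]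
    have h := hg.setIntegral_add_left x
    simp only [neg_add, add_neg_cancel_left] at h
    rw [fourierCoeff, mul_assoc, h, ← integral_mul_const]
    congr 2
    ext t
    rw [conj_expChar, expChar_add]
    ring
  have hexp (j : Fin 3 → ℤ) : Continuous fun t => f (x + t) * expChar j (-t) :=
    (hc.comp (continuous_const_add x)).mul ((continuous_expChar j).comp continuous_neg)
  rw [partialSum, sum_congr rfl fun j hj => hterm hj, ← mul_sum]
  simp only [dirichletKernel, mul_sum]
  rw [integral_finsetSum _ fun j _ => integrableOn_hexagon (hexp j), mul_sum]

lemma setIntegral_mul_cesaroKernel_neg {g : plane → ℂ} (hg : Continuous g) (δ : ℝ) (n : ℕ) :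
    ∫ t in hexagon, g t * cesaroKernel δ n (-t) ∂planeMeasure =
      ((1 / cesaroNumber δ n : ℝ) : ℂ) * ∑ k ∈ range (n + 1),
        (cesaroNumber (δ - 1) (n - k) : ℂ) *
          ∫ t in hexagon, g t * dirichletKernel k (-t) ∂planeMeasure := by
  have hD (k : ℕ) : Continuous fun t => g t * dirichletKernel k (-t) :=
    hg.mul ((continuous_dirichletKernel k).comp continuous_neg)
  have hint (k : ℕ) : IntegrableOn (fun t => (cesaroNumber (δ - 1) (n - k) : ℂ) *
      (g t * dirichletKernel k (-t))) hexagon planeMeasure :=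
    integrableOn_hexagon (continuous_const.mul (hD k))
  simp only [← integral_const_mul]
  rw [← integral_finsetSum _ fun k _ => hint k, ← integral_const_mul]
  congr 1
  ext t
  rw [cesaroKernel, mul_left_comm, mul_sum]
  congr 1
  exact sum_congr rfl fun k _ => by ring

lemma setIntegral_cesaroKernel_neg {δ : ℝ} (hδ : 0 < δ) (n : ℕ) :
    ∫ t in hexagon, cesaroKernel δ n (-t) ∂planeMeasure = planeMeasure.real hexagon := by
  have h := setIntegral_mul_cesaroKernel_neg (g := fun _ => 1) continuous_const δ n
  simp only [one_mul, setIntegral_dirichletKernel_neg] at h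
  have hA : (cesaroNumber δ n : ℂ) ≠ 0 :=
    Complex.ofReal_ne_zero.2 (cesaroNumber_pos (by linarith) n).ne'
  rw [h, ← sum_mul, ← Complex.ofReal_sum, sum_cesaroNumber_reflect hδ]
  push_cast
  field_simp

lemma sub_cesaroMean_eq_setIntegral {f : plane → ℂ} (hc : Continuous f) (hf : HPeriodic f)
    {δ : ℝ} (hδ : 0 < δ) (n : ℕ) (x : plane) :
    f x - cesaroMean δ n f x = (((planeMeasure.real hexagon)⁻¹ : ℝ) : ℂ) *
      ∫ t in hexagon, (f x - f (x + t)) * cesaroKernel δ n (-t) ∂planeMeasure := by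
  have hm : (planeMeasure.real hexagon : ℂ) ≠ 0 :=
    Complex.ofReal_ne_zero.2 measureReal_hexagon_pos.ne'
  have hfx : Continuous fun t => f (x + t) := hc.comp (continuous_const_add x)
  have hK : Continuous fun t => cesaroKernel δ n (-t) :=
    (continuous_cesaroKernel δ n).comp continuous_neg
  have h1 : IntegrableOn (fun t => f x * cesaroKernel δ n (-t)) hexagon planeMeasure :=
    integrableOn_hexagon (continuous_const.mul hK)
  have h2 : IntegrableOn (fun t => f (x + t) * cesaroKernel δ n (-t)) hexagon planeMeasure :=
    integrableOn_hexagon (hfx.mul hK)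
  simp only [sub_mul]
  rw [integral_sub h1 h2, integral_const_mul, setIntegral_cesaroKernel_neg hδ,
    setIntegral_mul_cesaroKernel_neg hfx, cesaroMean, mul_sub]
  congr 1
  · push_cast
    field_simp
  · simp only [partialSum_eq_setIntegral hc hf]
    simp only [mul_sum]
    exact sum_congr rfl fun k _ => by ring

/-- The approximation error is controlled by the absolute integral of the Cesàro kernel and by its
first absolute moment. -/
lemma norm_sub_cesaroMean_le {f : plane → ℂ} (hc : Continuous f) (hf : HPeriodic f)
    {δ u : ℝ} (hδ : 0 < δ) (hu : 0 < u) (n : ℕ) (x : plane) :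
    ‖f x - cesaroMean δ n f x‖ ≤ (planeMeasure.real hexagon)⁻¹ *
      (∫ t in hexagon, ‖cesaroKernel δ n (-t)‖ ∂planeMeasure +
        (∫ t in hexagon, ‖cesaroKernel δ n (-t)‖ * ‖t‖ ∂planeMeasure) / u) * modulus f u := by
  have hK : Continuous fun t => ‖cesaroKernel δ n (-t)‖ :=
    ((continuous_cesaroKernel δ n).comp continuous_neg).norm
  have hfx : Continuous fun t => f (x + t) := hc.comp (continuous_const_add x)
  rw [sub_cesaroMean_eq_setIntegral hc hf hδ, norm_mul, Complex.norm_real, norm_inv,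
    Real.norm_of_nonneg measureReal_hexagon_pos.le, mul_assoc]
  refine mul_le_mul_of_nonneg_left ?_ (inv_nonneg.2 measureReal_hexagon_pos.le)
  have hint : IntegrableOn (fun t => ‖cesaroKernel δ n (-t)‖ * ‖t‖) hexagon planeMeasure :=
    integrableOn_hexagon (hK.mul continuous_norm)
  rw [← integral_div, ← integral_add (integrableOn_hexagon hK) (hint.div_const u),
    ← integral_mul_const]
  refine (norm_integral_le_integral_norm _).trans (integral_mono ?_ ?_ fun t => ?_)
  · exact integrableOn_hexagon (((continuous_const.sub hfx).mul
      ((continuous_cesaroKernel δ n).comp continuous_neg)).norm)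
  · exact ((integrableOn_hexagon hK).add (hint.div_const u)).mul_const _
  · have := mul_le_mul_of_nonneg_right (hf.norm_sub_le_mul_modulus hc hu x t)
      (norm_nonneg (cesaroKernel δ n (-t)))
    simp only [norm_mul]
    refine this.trans_eq ?_
    ring

/-! ### Integrals of products of functions of two edge coordinates -/

/-- Two different edge coordinates are linear coordinates on the plane. -/
lemma exists_edgeCoord_equiv {i j : Fin 3} (hij : i ≠ j) :
    ∃ L : plane ≃L[ℝ] ℝ × ℝ, ∀ t, L t = (edgeCoord i t, edgeCoord j t) := by
  let l : plane →ₗ[ℝ] ℝ × ℝ :=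
    { toFun := fun t => (edgeCoord i t, edgeCoord j t)
      map_add' := fun s t => by
        ext <;> simp [edgeCoord] <;> ring
      map_smul' := fun c t => by
        ext <;> simp [edgeCoord] <;> ring }
  have hinj : Function.Injective l := by
    rw [← LinearMap.ker_eq_bot, LinearMap.ker_eq_bot']
    intro t ht
    have h1 : edgeCoord i t = 0 := congrArg Prod.fst ht
    have h2 : edgeCoord j t = 0 := congrArg Prod.snd ht
    have hs := edgeCoord_sum t
    have h (m : Fin 3) : |edgeCoord m t| ≤ 0 := by
      clear ht hs
      clear l
      have hs := edgeCoord_sum t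
      rw [abs_nonpos_iff]
      fin_cases i <;> fin_cases j <;> fin_cases m <;> simp at hij h1 h2 ⊢ <;> linarith
    have := norm_le_of_abs_edgeCoord_le h
    rwa [mul_zero, norm_le_zero_iff] at this
  have hdim : Module.finrank ℝ plane = Module.finrank ℝ (ℝ × ℝ) := pairEquiv.finrank_eq.symm
  have hbij : Function.Bijective l :=
    ⟨hinj, (LinearMap.injective_iff_surjective_of_finrank_eq_finrank hdim).1 hinj⟩
  exact ⟨(LinearEquiv.ofBijective l hbij).toContinuousLinearEquiv, fun t => rfl⟩

lemma continuous_edgeCoord (i : Fin 3) : Continuous (edgeCoord i) :=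
  ((continuous_coord _).sub (continuous_coord _)).div_const 3

/-- By uniqueness of Haar measure the change to the coordinates `sᵢ`, `sⱼ` multiplies the measure by a
constant. -/
lemma exists_setIntegral_mul_le {i j : Fin 3} (hij : i ≠ j) :
    ∃ C : ℝ, 0 ≤ C ∧ ∀ P Q : ℝ → ℝ, Continuous P → Continuous Q → (∀ a, 0 ≤ P a) →
      (∀ a, 0 ≤ Q a) → ∫ t in hexagon, P (edgeCoord i t) * Q (edgeCoord j t) ∂planeMeasure ≤
        C * ((∫ a in Set.Icc (-1) 1, P a) * ∫ a in Set.Icc (-1) 1, Q a) := by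
  obtain ⟨L, hL⟩ := exists_edgeCoord_equiv hij
  have hemb : MeasurableEmbedding L := L.toHomeomorph.measurableEmbedding
  have hHaar : (planeMeasure.map L).IsAddHaarMeasure := inferInstance
  have hc := Measure.isAddLeftInvariant_eq_smul (planeMeasure.map L) (volume : Measure (ℝ × ℝ))
  set c := Measure.addHaarScalarFactor (planeMeasure.map L) (volume : Measure (ℝ × ℝ))
  refine ⟨c, c.2, fun P Q hP hQ hP0 hQ0 => ?_⟩
  set S : Set (ℝ × ℝ) := Set.Icc (-1) 1 ×ˢ Set.Icc (-1) 1 with hS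
  have hcomp : IsCompact (L ⁻¹' S) :=
    L.toHomeomorph.isCompact_preimage.2 (isCompact_Icc.prod isCompact_Icc)
  have hcont : Continuous fun t => P (edgeCoord i t) * Q (edgeCoord j t) :=
    (hP.comp (continuous_edgeCoord i)).mul (hQ.comp (continuous_edgeCoord j))
  have hsub : hexagon ⊆ L ⁻¹' S := by
    intro t ht
    have h (i : Fin 3) := abs_le.1 (abs_edgeCoord_le_of_mem ht i)
    rw [Set.mem_preimage, hL]
    exact ⟨⟨by linarith [(h i).1], by linarith [(h i).2]⟩,
      ⟨by linarith [(h j).1], by linarith [(h j).2]⟩⟩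
  calc _ ≤ ∫ t in L ⁻¹' S, P (edgeCoord i t) * Q (edgeCoord j t) ∂planeMeasure :=
        setIntegral_mono_set (hcont.continuousOn.integrableOn_compact hcomp)
          (Filter.Eventually.of_forall fun t => mul_nonneg (hP0 _) (hQ0 _))
          (Filter.Eventually.of_forall hsub)
    _ = ∫ t in L ⁻¹' S, (fun p : ℝ × ℝ => P p.1 * Q p.2) (L t) ∂planeMeasure := by
        simp only [hL]
    _ = ∫ p in S, P p.1 * Q p.2 ∂(planeMeasure.map L) :=
        (hemb.setIntegral_map (fun p : ℝ × ℝ => P p.1 * Q p.2) S).symm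
    _ = _ := by
        rw [hc, Measure.restrict_smul, integral_smul_nnreal_measure, Measure.volume_eq_prod, hS,
          setIntegral_prod_mul, NNReal.smul_def, smul_eq_mul]

lemma exists_setIntegral_le_mul_integral :
    ∃ C : ℝ, 0 < C ∧ ∀ (P Q : ℝ → ℝ) (g : plane → ℝ) (B : ℝ), Continuous P → Continuous Q →
      (∀ a, 0 ≤ P a) → (∀ a, 0 ≤ Q a) → Continuous g → 0 ≤ B →
      (∀ t ∈ hexagon, ∃ i j, i ≠ j ∧ g t ≤ B * (P (edgeCoord i t) * Q (edgeCoord j t))) →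
      ∫ t in hexagon, g t ∂planeMeasure ≤
        C * (B * ((∫ a in Set.Icc (-1) 1, P a) * ∫ a in Set.Icc (-1) 1, Q a)) := by
  have h (p : Fin 3 × Fin 3) : ∃ C : ℝ, 0 ≤ C ∧ (p.1 ≠ p.2 → ∀ P Q : ℝ → ℝ, Continuous P →
      Continuous Q → (∀ a, 0 ≤ P a) → (∀ a, 0 ≤ Q a) →
      ∫ t in hexagon, P (edgeCoord p.1 t) * Q (edgeCoord p.2 t) ∂planeMeasure ≤
        C * ((∫ a in Set.Icc (-1) 1, P a) * ∫ a in Set.Icc (-1) 1, Q a)) := by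
    by_cases hp : p.1 = p.2
    · exact ⟨0, le_rfl, fun h => (h hp).elim⟩
    · obtain ⟨C, hC, h⟩ := exists_setIntegral_mul_le hp
      exact ⟨C, hC, fun _ => h⟩
  choose c hc0 hc using h
  have hsum0 : 0 ≤ ∑ p ∈ (univ : Finset (Fin 3)).offDiag, c p := sum_nonneg fun p _ => hc0 p
  refine ⟨∑ p ∈ (univ : Finset (Fin 3)).offDiag, c p + 1, by linarith,
    fun P Q g B hP hQ hP0 hQ0 hg hB hbd => ?_⟩
  set I := (∫ a in Set.Icc (-1) 1, P a) * ∫ a in Set.Icc (-1) 1, Q a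
  have hI : 0 ≤ I := mul_nonneg (integral_nonneg hP0) (integral_nonneg hQ0)
  have hcont (p : Fin 3 × Fin 3) :
      Continuous fun t => P (edgeCoord p.1 t) * Q (edgeCoord p.2 t) :=
    (hP.comp (continuous_edgeCoord _)).mul (hQ.comp (continuous_edgeCoord _))
  calc ∫ t in hexagon, g t ∂planeMeasure
      ≤ ∫ t in hexagon, B * ∑ p ∈ (univ : Finset (Fin 3)).offDiag,
          P (edgeCoord p.1 t) * Q (edgeCoord p.2 t) ∂planeMeasure := by
        refine setIntegral_mono_on (integrableOn_hexagon hg) (integrableOn_hexagon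
          (continuous_const.mul (continuous_finsetSum _ fun p _ => hcont p)))
          measurableSet_hexagon fun t ht => ?_
        obtain ⟨i, j, hij, h⟩ := hbd t ht
        refine h.trans (mul_le_mul_of_nonneg_left ?_ hB)
        exact single_le_sum (f := fun p : Fin 3 × Fin 3 =>
          P (edgeCoord p.1 t) * Q (edgeCoord p.2 t))
          (fun p _ => mul_nonneg (hP0 _) (hQ0 _)) (a := (i, j)) (by simp [hij])
    _ = B * ∑ p ∈ (univ : Finset (Fin 3)).offDiag,
          ∫ t in hexagon, P (edgeCoord p.1 t) * Q (edgeCoord p.2 t) ∂planeMeasure := by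
        rw [integral_const_mul, integral_finsetSum _ fun p _ => integrableOn_hexagon (hcont p)]
    _ ≤ B * ∑ p ∈ (univ : Finset (Fin 3)).offDiag, c p * I := by
        refine mul_le_mul_of_nonneg_left (sum_le_sum fun p hp => ?_) hB
        exact hc p (mem_offDiag.1 hp).2.2 P Q hP hQ hP0 hQ0
    _ ≤ _ := by
        rw [← sum_mul]
        nlinarith [mul_nonneg hB hI]

/-! ### One-dimensional integrals of truncated powers -/

lemma truncPow_neg (ε r a : ℝ) : truncPow ε r (-a) = truncPow ε r a := by
  rw [truncPow, truncPow, abs_neg]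

lemma continuous_truncPow {ε : ℝ} (hε : 0 < ε) (r : ℝ) : Continuous (truncPow ε r) :=
  (continuous_abs.max continuous_const).rpow_const fun a =>
    Or.inl (hε.trans_le (le_max_right |a| ε)).ne'

lemma integral_truncPow {ε : ℝ} (hε : 0 < ε) (hε1 : ε ≤ 1) (r : ℝ) :
    ∫ a in Set.Icc (-1) 1, truncPow ε r a = 2 * (ε ^ (1 - r) + ∫ a in ε..1, a ^ (-r)) := by
  have hint (a b : ℝ) : IntervalIntegrable (truncPow ε r) volume a b :=
    (continuous_truncPow hε r).intervalIntegrable a b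
  have hneg : ∫ a in (-1 : ℝ)..0, truncPow ε r a = ∫ a in (0 : ℝ)..1, truncPow ε r a := by
    have := intervalIntegral.integral_comp_neg (a := 0) (b := 1) (truncPow ε r)
    simp only [truncPow_neg, neg_zero] at this
    exact this.symm
  have h1 : ∫ a in (0 : ℝ)..ε, truncPow ε r a = ε ^ (1 - r) := by
    have : ∫ a in (0 : ℝ)..ε, truncPow ε r a = ∫ _ in (0 : ℝ)..ε, ε ^ (-r) := by
      refine intervalIntegral.integral_congr fun a ha => ?_
      rw [Set.uIcc_of_le hε.le] at ha
      simp only [truncPow]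
      rw [abs_of_nonneg ha.1, max_eq_right ha.2]
    rw [this, intervalIntegral.integral_const, sub_zero, smul_eq_mul, sub_eq_add_neg,
      Real.rpow_add hε, Real.rpow_one]
  have h2 : ∫ a in ε..1, truncPow ε r a = ∫ a in ε..1, a ^ (-r) := by
    refine intervalIntegral.integral_congr fun a ha => ?_
    rw [Set.uIcc_of_le hε1] at ha
    simp only [truncPow]
    rw [abs_of_nonneg (hε.le.trans ha.1), max_eq_left ha.1]
  rw [integral_Icc_eq_integral_Ioc, ← intervalIntegral.integral_of_le (by norm_num),
    ← intervalIntegral.integral_add_adjacent_intervals (hint (-1) 0) (hint 0 1), hneg,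
    ← intervalIntegral.integral_add_adjacent_intervals (hint 0 ε) (hint ε 1), h1, h2]
  ring

lemma integral_truncPow_one {ε : ℝ} (hε : 0 < ε) (hε1 : ε ≤ 1) :
    ∫ a in Set.Icc (-1) 1, truncPow ε 1 a = 2 * (1 + Real.log ε⁻¹) := by
  rw [integral_truncPow hε hε1]
  simp only [Real.rpow_neg_one]
  rw [integral_inv_of_pos hε one_pos, one_div, sub_self, Real.rpow_zero]

lemma integral_truncPow_one_add_le {ε δ : ℝ} (hε : 0 < ε) (hε1 : ε ≤ 1) (hδ : 0 < δ) :
    ∫ a in Set.Icc (-1) 1, truncPow ε (1 + δ) a ≤ 2 * (1 + 1 / δ) * ε ^ (-δ) := by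
  rw [integral_truncPow hε hε1, integral_rpow (Or.inr ⟨by linarith, by
    rw [Set.uIcc_of_le hε1]; exact fun h => absurd h.1 (not_le.2 hε)⟩), Real.one_rpow,
    show (1 : ℝ) - (1 + δ) = -δ by ring, show -(1 + δ) + 1 = -δ by ring, div_neg, ← neg_div,
    neg_sub, sub_div]
  have : 0 < 1 / δ := by positivity
  have e : 2 * (1 + 1 / δ) * ε ^ (-δ) = 2 * (ε ^ (-δ) + ε ^ (-δ) / δ) := by ring
  rw [e]
  linarith

lemma integral_truncPow_le_of_lt_one {ε δ : ℝ} (hε : 0 < ε) (hε1 : ε ≤ 1) (hδ : δ < 1) :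
    ∫ a in Set.Icc (-1) 1, truncPow ε δ a ≤ 2 * (1 + 1 / (1 - δ)) := by
  have h1 : 0 < 1 - δ := by linarith
  rw [integral_truncPow hε hε1, integral_rpow (Or.inl (by linarith)), Real.one_rpow,
    show -δ + 1 = 1 - δ by ring, sub_div]
  have h2 : ε ^ (1 - δ) ≤ 1 := Real.rpow_le_one hε.le hε1 h1.le
  have h3 : 0 ≤ ε ^ (1 - δ) / (1 - δ) := by positivity
  linarith

/-! ### Moments of the Cesàro kernel and the approximation theorem -/

lemma half_le_log_nat_add_one {n : ℕ} (hn : 1 ≤ n) : 1 / 2 ≤ Real.log ((n : ℝ) + 1) := by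
  have h : (2 : ℝ) ≤ n + 1 := by
    have : (1 : ℝ) ≤ n := by exact_mod_cast hn
    linarith
  have := Real.log_le_log (by norm_num) h
  linarith [Real.log_two_gt_d9]

lemma continuous_norm_cesaroKernel_neg (δ : ℝ) (n : ℕ) :
    Continuous fun t => ‖cesaroKernel δ n (-t)‖ :=
  ((continuous_cesaroKernel δ n).comp continuous_neg).norm

lemma abs_edgeCoord_neg_le_of_mem {t : plane} (ht : t ∈ hexagon) (i : Fin 3) :
    |edgeCoord i (-t)| ≤ 2 / 3 := by
  rw [edgeCoord_neg, abs_neg]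
  exact abs_edgeCoord_le_of_mem ht i

/-- For `δ ≥ 1` the Cesàro kernels are bounded in `L¹`, with first absolute moment of order
`(log n)² / n`. -/
lemma exists_moments_le_of_one_le {δ : ℝ} (hδ : 1 ≤ δ) : ∃ C, 0 < C ∧ ∀ n : ℕ, 1 ≤ n →
    ∫ t in hexagon, ‖cesaroKernel δ n (-t)‖ ∂planeMeasure ≤ C ∧
    ∫ t in hexagon, ‖cesaroKernel δ n (-t)‖ * ‖t‖ ∂planeMeasure ≤
      C * (Real.log ((n : ℝ) + 1) ^ 2 / ((n : ℝ) + 1)) := by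
  obtain ⟨C, hC, h⟩ := exists_setIntegral_le_mul_integral
  refine ⟨1152 * C * δ, by positivity, fun n hn => ?_⟩
  have hlog := half_le_log_nat_add_one hn
  have hN : (0 : ℝ) < (n : ℝ) + 1 := by positivity
  have hK := continuous_norm_cesaroKernel_neg δ n
  have hbd {t : plane} (ht : t ∈ hexagon) :=
    norm_cesaroKernel_le_of_one_le hδ n (abs_edgeCoord_neg_le_of_mem ht)
  simp only [edgeCoord_neg, truncPow_neg, norm_neg] at hbd
  set N : ℝ := (n : ℝ) + 1 with hNdef
  have hε : 0 < N⁻¹ := inv_pos.2 hN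
  have hε1 : N⁻¹ ≤ 1 := inv_le_one_of_one_le₀ (by linarith [(Nat.cast_nonneg n : (0 : ℝ) ≤ n)])
  constructor
  · have h1 := h (truncPow N⁻¹ (3 / 2)) (truncPow N⁻¹ (3 / 2)) _ (16 * δ / N)
      (continuous_truncPow hε _) (continuous_truncPow hε _) (fun _ => truncPow_nonneg _ _)
      (fun _ => truncPow_nonneg _ _) hK (by positivity) fun t ht =>
        let ⟨i, j, hij, h1, _⟩ := hbd ht
        ⟨i, j, hij, h1⟩
    have h2 := integral_truncPow_one_add_le hε hε1 (by norm_num : (0 : ℝ) < 1 / 2)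
    rw [show (1 : ℝ) + 1 / 2 = 3 / 2 by norm_num, Real.inv_rpow hN.le,
      ← Real.rpow_neg hN.le, neg_neg] at h2
    have h0 : 0 ≤ ∫ a in Set.Icc (-1) 1, truncPow N⁻¹ (3 / 2) a :=
      integral_nonneg fun _ => truncPow_nonneg _ _
    have hs : N ^ (1 / 2 : ℝ) * N ^ (1 / 2 : ℝ) = N := by
      rw [← Real.rpow_add hN]; norm_num
    refine h1.trans ?_
    calc _ ≤ C * (16 * δ / N * ((2 * (1 + 1 / (1 / 2)) * N ^ (1 / 2 : ℝ)) *
          (2 * (1 + 1 / (1 / 2)) * N ^ (1 / 2 : ℝ)))) := by gcongr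
      _ = 576 * C * δ * (N ^ (1 / 2 : ℝ) * N ^ (1 / 2 : ℝ)) / N := by ring
      _ = 576 * C * δ := by rw [hs]; field_simp
      _ ≤ _ := by nlinarith [mul_pos hC (by linarith : 0 < δ)]
  · have h1 := h (truncPow N⁻¹ 1) (truncPow N⁻¹ 1) _ (32 * δ / N)
      (continuous_truncPow hε _) (continuous_truncPow hε _) (fun _ => truncPow_nonneg _ _)
      (fun _ => truncPow_nonneg _ _) (hK.mul continuous_norm) (by positivity) fun t ht =>
        let ⟨i, j, hij, _, h1⟩ := hbd ht
        ⟨i, j, hij, h1⟩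
    rw [integral_truncPow_one hε hε1, inv_inv] at h1
    refine h1.trans ?_
    have h2 : 2 * (1 + Real.log N) ≤ 6 * Real.log N := by linarith
    calc _ ≤ C * (32 * δ / N * ((6 * Real.log N) * (6 * Real.log N))) := by gcongr
      _ = _ := by ring

/-- For `0 < δ < 1` the `L¹` norm of the Cesàro kernel is at most of order `log n`, and its first
absolute moment at most of order `log n / n ^ δ`. -/
lemma exists_moments_le_of_lt_one {δ : ℝ} (h0 : 0 < δ) (h1 : δ < 1) : ∃ C, 0 < C ∧ ∀ n : ℕ,
    1 ≤ n →
    ∫ t in hexagon, ‖cesaroKernel δ n (-t)‖ ∂planeMeasure ≤ C * Real.log ((n : ℝ) + 1) ∧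
    ∫ t in hexagon, ‖cesaroKernel δ n (-t)‖ * ‖t‖ ∂planeMeasure ≤
      C * (Real.log ((n : ℝ) + 1) / ((n : ℝ) + 1) ^ δ) := by
  obtain ⟨C, hC, h⟩ := exists_setIntegral_le_mul_integral
  obtain ⟨C', hC', hker⟩ := exists_norm_cesaroKernel_le_of_lt_one h0 h1
  have hd1 : 0 < 1 / δ := by positivity
  have hd2 : 0 < 1 / (1 - δ) := one_div_pos.2 (by linarith)
  refine ⟨40 * C * C' * (1 + 1 / δ + 1 / (1 - δ)), by positivity, fun n hn => ?_⟩
  have hlog := half_le_log_nat_add_one hn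
  have hN : (0 : ℝ) < (n : ℝ) + 1 := by positivity
  have hK := continuous_norm_cesaroKernel_neg δ n
  have hbd {t : plane} (ht : t ∈ hexagon) := hker n (-t) (abs_edgeCoord_neg_le_of_mem ht)
  simp only [edgeCoord_neg, truncPow_neg, norm_neg] at hbd
  set N : ℝ := (n : ℝ) + 1 with hNdef
  have hN1 : 1 ≤ N := by linarith [(Nat.cast_nonneg n : (0 : ℝ) ≤ n)]
  have hε : 0 < N⁻¹ := inv_pos.2 hN
  have hε1 : N⁻¹ ≤ 1 := inv_le_one_of_one_le₀ hN1
  have hε' : 0 < (N ^ 3)⁻¹ := by positivity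
  have hε1' : (N ^ 3)⁻¹ ≤ 1 := inv_le_one_of_one_le₀ (one_le_pow₀ hN1)
  have hP : ∫ a in Set.Icc (-1) 1, truncPow (N ^ 3)⁻¹ 1 a ≤ 10 * Real.log N := by
    rw [integral_truncPow_one hε' hε1', inv_inv, Real.log_pow]
    push_cast
    linarith
  have hP0 : 0 ≤ ∫ a in Set.Icc (-1) 1, truncPow (N ^ 3)⁻¹ 1 a :=
    integral_nonneg fun _ => truncPow_nonneg _ _
  have hNN : N ^ (-δ) * N ^ δ = 1 := by
    rw [← Real.rpow_add hN]; simp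
  constructor
  · refine (h (truncPow N⁻¹ (1 + δ)) (truncPow (N ^ 3)⁻¹ 1) _ (C' * N ^ (-δ))
      (continuous_truncPow hε _) (continuous_truncPow hε' _) (fun _ => truncPow_nonneg _ _)
      (fun _ => truncPow_nonneg _ _) hK (by positivity) fun t ht =>
        let ⟨i, j, hij, h1, _⟩ := hbd ht
        ⟨i, j, hij, h1⟩).trans ?_
    have h2 := integral_truncPow_one_add_le hε hε1 h0
    rw [Real.inv_rpow hN.le, ← Real.rpow_neg hN.le, neg_neg] at h2
    calc _ ≤ C * (C' * N ^ (-δ) * ((2 * (1 + 1 / δ) * N ^ δ) * (10 * Real.log N))) := by gcongr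
      _ = 20 * C * C' * (1 + 1 / δ) * (N ^ (-δ) * N ^ δ) * Real.log N := by ring
      _ = 20 * C * C' * (1 + 1 / δ) * Real.log N := by rw [hNN, mul_one]
      _ ≤ _ := by
        have hCC : 0 < C * C' := mul_pos hC hC'
        refine mul_le_mul_of_nonneg_right ?_ (by linarith)
        nlinarith [mul_pos hCC hd1, mul_pos hCC hd2]
  · refine (h (truncPow N⁻¹ δ) (truncPow (N ^ 3)⁻¹ 1) _ (2 * C' * N ^ (-δ))
      (continuous_truncPow hε _) (continuous_truncPow hε' _) (fun _ => truncPow_nonneg _ _)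
      (fun _ => truncPow_nonneg _ _) (hK.mul continuous_norm) (by positivity) fun t ht =>
        let ⟨i, j, hij, _, h1⟩ := hbd ht
        ⟨i, j, hij, h1⟩).trans ?_
    have h2 := integral_truncPow_le_of_lt_one hε hε1 h1
    calc _ ≤ C * (2 * C' * N ^ (-δ) * ((2 * (1 + 1 / (1 - δ))) * (10 * Real.log N))) := by
          gcongr
      _ = 40 * C * C' * (1 + 1 / (1 - δ)) * (Real.log N / N ^ δ) := by
          rw [Real.rpow_neg hN.le]; ring
      _ ≤ _ := by
        gcongr
        linarith

lemma uniformNorm_le {g : plane → ℂ} {M : ℝ} (h : ∀ t, ‖g t‖ ≤ M) : uniformNorm g ≤ M := by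
  refine Real.sSup_le ?_ ((norm_nonneg _).trans (h 0))
  rintro _ ⟨t, -, rfl⟩
  exact h t

end HexFourier

theorem theorem4 :
    (∀ δ : ℝ, 0 < δ → δ < 1 →
      ∃ K : ℝ, 0 < K ∧ ∀ f : HexFourier.plane → ℂ, Continuous f → HexFourier.HPeriodic f →
        ∀ n : ℕ, 1 ≤ n →
          HexFourier.uniformNorm (fun t => f t - HexFourier.cesaroMean δ n f t) ≤
            K * (Real.log ((n : ℝ) + 1) *
              HexFourier.modulus f (Real.log ((n : ℝ) + 1) / ((n : ℝ) + 1) ^ δ))) ∧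
    (∀ δ : ℝ, 1 ≤ δ →
      ∃ K : ℝ, 0 < K ∧ ∀ f : HexFourier.plane → ℂ, Continuous f → HexFourier.HPeriodic f →
        ∀ n : ℕ, 1 ≤ n →
          HexFourier.uniformNorm (fun t => f t - HexFourier.cesaroMean δ n f t) ≤
            K * HexFourier.modulus f ((Real.log ((n : ℝ) + 1)) ^ 2 / ((n : ℝ) + 1))) := by
  have hΩ := HexFourier.measureReal_hexagon_pos
  have hmod {f : HexFourier.plane → ℂ} (hc : Continuous f) (hf : HexFourier.HPeriodic f) {u : ℝ}
      (hu : 0 < u) : 0 ≤ HexFourier.modulus f u :=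
    (norm_nonneg _).trans (hf.norm_sub_le_modulus hc 0 (t := 0) (by simpa using hu.le))
  constructor
  · intro δ h0 h1
    obtain ⟨C, hC, h⟩ := HexFourier.exists_moments_le_of_lt_one h0 h1
    refine ⟨(HexFourier.planeMeasure.real HexFourier.hexagon)⁻¹ * (3 * C), by positivity,
      fun f hc hf n hn => HexFourier.uniformNorm_le fun x => ?_⟩
    obtain ⟨hI0, hI1⟩ := h n hn
    have hlog := HexFourier.half_le_log_nat_add_one hn
    have hu : 0 < Real.log ((n : ℝ) + 1) / ((n : ℝ) + 1) ^ δ := by positivity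
    refine (HexFourier.norm_sub_cesaroMean_le hc hf h0 hu n x).trans ?_
    rw [← mul_assoc, mul_assoc _ (3 * C)]
    refine mul_le_mul_of_nonneg_right ?_ (hmod hc hf hu)
    refine mul_le_mul_of_nonneg_left ?_ (inv_nonneg.2 hΩ.le)
    have := (div_le_iff₀ hu).2 hI1
    nlinarith
  · intro δ h1
    obtain ⟨C, hC, h⟩ := HexFourier.exists_moments_le_of_one_le h1
    refine ⟨(HexFourier.planeMeasure.real HexFourier.hexagon)⁻¹ * (2 * C), by positivity,
      fun f hc hf n hn => HexFourier.uniformNorm_le fun x => ?_⟩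
    obtain ⟨hI0, hI1⟩ := h n hn
    have hlog := HexFourier.half_le_log_nat_add_one hn
    have hu : 0 < Real.log ((n : ℝ) + 1) ^ 2 / ((n : ℝ) + 1) := by positivity
    refine (HexFourier.norm_sub_cesaroMean_le hc hf (by linarith) hu n x).trans ?_
    refine mul_le_mul_of_nonneg_right ?_ (hmod hc hf hu)
    refine mul_le_mul_of_nonneg_left ?_ (inv_nonneg.2 hΩ.le)
    have := (div_le_iff₀ hu).2 hI1
    linarith
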